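/- Let $N\ge 2$ be an integer and let $0<\ell<N$, $0\le\alpha<1$, $\beta\in\mathbb R$ with $\alpha+\beta>0$, and $1\le q<\infty$ with $$\frac1q=1+\frac{\alpha+\beta-\ell}{N}.$$ Let $I_\ell$ denote the Riesz potential $$I_\ell u(x)=\gamma_{N,\ell}\int_{\mathbb R^N}\frac{u(y)}{|x-y|^{N-\ell}}\,dy,\qquad \gamma_{N,\ell}=\pi^{\ell-\frac N2}\,\frac{\Gamma((N-\ell)/2)}{\Gamma(\ell/2)},$$ and let $Ru=(R_1u,\dots,R_Nu)$ denote the vector Riesz transform, $$R_ju(x)=\lim_{\varepsilon\to0^+}c_N\int_{|y|>\varepsilon}\frac{y_j}{|y|^{N+1}}\,u(x-y)\,dy,\qquad c_N=\pi^{-\frac{N+1}2}\,\Gamma\!\left(\tfrac{N+1}2\right).$$ Then there is a constant $C>0$, depending only on $N,\ell,\alpha,\beta$, such that $$\big\|\,|x|^{-\beta}I_\ell u\,\big\|_{L^q(\mathbb R^N)}\le C\,\big\|\,|x|^{\alpha}Ru\,\big\|_{L^1(\mathbb R^N)}$$ for every (real- or complex-valued) $u\in C_c^\infty(\mathbb R^N)$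 such that $|x|^\alpha Ru\in L^1(\mathbb R^N)$. -/

import Mathlib

open MeasureTheory Filter Topology
open scoped ContDiff

namespace SteinWeiss

noncomputable section

/-- The normalising constant `γ_{N,ℓ} = π^{ℓ - N/2} Γ((N-ℓ)/2) / Γ(ℓ/2)` of the Riesz potential. -/
def potentialConst (N : ℕ) (l : ℝ) : ℝ :=
  Real.pi ^ (l - (N : ℝ) / 2) * Real.Gamma (((N : ℝ) - l) / 2) / Real.Gamma (l / 2)

/-- The Riesz potential `I_ℓ u (x) = γ_{N,ℓ} ∫ u(y) / |x-y|^{N-ℓ} dy` on `ℝ^N`. -/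
def rieszPotential {𝕜 : Type*} [RCLike 𝕜] {N : ℕ} (l : ℝ)
    (u : EuclideanSpace ℝ (Fin N) → 𝕜) (x : EuclideanSpace ℝ (Fin N)) : 𝕜 :=
  potentialConst N l • ∫ y, (1 / ‖x - y‖ ^ ((N : ℝ) - l)) • u y

/-- The constant `c_N = π^{-(N+1)/2} Γ((N+1)/2)` of the Riesz transforms. -/
def transformConst (N : ℕ) : ℝ :=
  Real.pi ^ (-(((N : ℝ) + 1) / 2)) * Real.Gamma (((N : ℝ) + 1) / 2)

/-- The kernel `G_j(y) = c_N y_j / |y|^{N+1}` of the `j`-th Riesz transform. -/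
def rieszKernel {N : ℕ} (j : Fin N) (y : EuclideanSpace ℝ (Fin N)) : ℝ :=
  transformConst N * (y j / ‖y‖ ^ (N + 1))

/-- The truncated integral `∫_{|y| > ε} G_j(y) u(x-y) dy`. -/
def truncatedRiesz {𝕜 : Type*} [RCLike 𝕜] {N : ℕ} (j : Fin N)
    (u : EuclideanSpace ℝ (Fin N) → 𝕜) (x : EuclideanSpace ℝ (Fin N)) (ε : ℝ) : 𝕜 :=
  ∫ y in {y : EuclideanSpace ℝ (Fin N) | ε < ‖y‖}, rieszKernel j y • u (x - y)

/-- The `j`-th Riesz transform `R_j u = G_j * u`, the convolution being taken in the principal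
value sense, since `G_j` is not locally integrable. For `u ∈ C_c^∞` the limit exists at every
point, see `tendsto_truncatedRiesz`. -/
def rieszTransform {𝕜 : Type*} [RCLike 𝕜] {N : ℕ} (j : Fin N)
    (u : EuclideanSpace ℝ (Fin N) → 𝕜) (x : EuclideanSpace ℝ (Fin N)) : 𝕜 :=
  limUnder (𝓝[>] (0 : ℝ)) (truncatedRiesz j u x)

/-- The principal value defining `R_j u` exists at every point for `u ∈ C_c^∞`. -/
theorem tendsto_truncatedRiesz {𝕜 : Type*} [RCLike 𝕜] {N : ℕ} (j : Fin N)
    {u : EuclideanSpace ℝ (Fin N) → 𝕜} (hu : ContDiff ℝ ∞ u) (hc : HasCompactSupport u)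
    (x : EuclideanSpace ℝ (Fin N)) :
    Tendsto (truncatedRiesz j u x) (𝓝[>] (0 : ℝ)) (𝓝 (rieszTransform j u x)) := by
  suffices h : ∃ z, Tendsto (truncatedRiesz j u x) (𝓝[>] (0 : ℝ)) (𝓝 z) from
    tendsto_nhds_limUnder h
  have hN : 1 ≤ N := Nat.one_le_of_lt j.2
  obtain ⟨L, hL⟩ := ContDiff.lipschitzWith_of_hasCompactSupport hc hu (by simp)
  obtain ⟨M, hM⟩ := hc.exists_bound_of_continuous hu.continuous
  obtain ⟨r, hr⟩ := hc.isCompact.isBounded.subset_ball (0 : EuclideanSpace ℝ (Fin N))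
  have hzero : ∀ y : EuclideanSpace ℝ (Fin N), r + ‖x‖ ≤ ‖y‖ → u (x - y) = 0 := by
    intro y hy
    by_contra hne
    have h1 := hr (subset_tsupport u (Function.mem_support.2 hne))
    rw [mem_ball_zero_iff] at h1
    have h2 := norm_sub_norm_le y x
    rw [norm_sub_rev y x] at h2
    linarith
  have hkm : Measurable (rieszKernel j : EuclideanSpace ℝ (Fin N) → ℝ) := by
    unfold rieszKernel
    fun_prop
  have hkb : ∀ y : EuclideanSpace ℝ (Fin N),
      ‖rieszKernel j y‖ ≤ |transformConst N| * (‖y‖ / ‖y‖ ^ (N + 1)) := by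
    intro y
    rw [rieszKernel, norm_mul, norm_div, norm_pow, norm_norm, Real.norm_eq_abs]
    gcongr
    exact PiLp.norm_apply_le y j
  have hodd : ∀ y : EuclideanSpace ℝ (Fin N), rieszKernel j (-y) = - rieszKernel j y := by
    intro y
    simp [rieszKernel, neg_div]
  have hpow : ∀ y : EuclideanSpace ℝ (Fin N), y ≠ 0 →
      ‖y‖ / ‖y‖ ^ (N + 1) * ‖y‖ = ‖y‖ ^ (-((N : ℝ) - 1)) := by
    intro y hy
    have h0 : 0 < ‖y‖ := norm_pos_iff.2 hy
    rw [neg_sub, Real.rpow_sub h0, Real.rpow_one, Real.rpow_natCast]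
    field_simp
    ring
  set h : EuclideanSpace ℝ (Fin N) → 𝕜 :=
    fun y => rieszKernel j y • (u (x - y) - u (x + y)) with hh
  have hcont : Continuous u := hu.continuous
  have hhm : AEStronglyMeasurable h volume := by
    refine (hkm.aestronglyMeasurable).smul ?_
    exact Continuous.aestronglyMeasurable (by fun_prop)
  have hhb : ∀ᵐ y ∂(volume : Measure (EuclideanSpace ℝ (Fin N))),
      ‖h y‖ ≤ (|transformConst N| * (2 * L)) * ‖y‖ ^ (-((N : ℝ) - 1)) := by
    refine ae_of_all _ fun y => ?_
    by_cases hy : y = 0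
    · subst hy
      have : h 0 = 0 := by simp [hh]
      rw [this, norm_zero]
      positivity
    · rw [← hpow y hy]
      have h1 : ‖u (x - y) - u (x + y)‖ ≤ 2 * L * ‖y‖ := by
        have := hL.norm_sub_le (x - y) (x + y)
        have h2 : ‖x - y - (x + y)‖ = 2 * ‖y‖ := by
          have : x - y - (x + y) = (-2 : ℝ) • y := by module
          rw [this, norm_smul]
          norm_num
        rw [h2] at this
        linarith
      calc ‖h y‖ = ‖rieszKernel j y‖ * ‖u (x - y) - u (x + y)‖ := norm_smul _ _
        _ ≤ (|transformConst N| * (‖y‖ / ‖y‖ ^ (N + 1))) * (2 * L * ‖y‖) := by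
          gcongr
          exact hkb y
        _ = _ := by ring
  have hloc : LocallyIntegrable h volume := by
    refine locallyIntegrable_of_norm_le_rpow (α := (N : ℝ) - 1) ?_ ?_ hhb hhm
    · simpa using hN
    · simp
  have hint : Integrable h volume := by
    have hK := hloc.integrableOn_isCompact
      (isCompact_closedBall (0 : EuclideanSpace ℝ (Fin N)) (r + ‖x‖))
    refine (integrableOn_iff_integrable_of_support_subset ?_).1 hK
    intro y hy
    rw [mem_closedBall_zero_iff]
    by_contra hlt
    push Not at hlt
    have h1 := hzero y hlt.le
    have h2 := hzero (-y) (by rw [norm_neg]; exact hlt.le)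
    rw [sub_neg_eq_add] at h2
    exact hy (by simp [hh, h1, h2])
  have hmS : ∀ ε : ℝ, MeasurableSet {y : EuclideanSpace ℝ (Fin N) | ε < ‖y‖} := fun ε =>
    measurableSet_lt measurable_const measurable_norm
  have key : ∀ ε : ℝ, 0 < ε → truncatedRiesz j u x ε =
      (2⁻¹ : ℝ) • ∫ y, {y : EuclideanSpace ℝ (Fin N) | ε < ‖y‖}.indicator h y := by
    intro ε hε
    set S := {y : EuclideanSpace ℝ (Fin N) | ε < ‖y‖} with hS
    set g : EuclideanSpace ℝ (Fin N) → 𝕜 :=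
      S.indicator fun y => rieszKernel j y • u (x - y) with hg
    have hgint : Integrable g volume := by
      have hcs : HasCompactSupport fun y => u (x - y) :=
        HasCompactSupport.intro
          (isCompact_closedBall (0 : EuclideanSpace ℝ (Fin N)) (r + ‖x‖)) fun y hy => by
            rw [mem_closedBall_zero_iff, not_le] at hy
            exact hzero y hy.le
      have hi : Integrable (fun y => u (x - y)) volume :=
        Continuous.integrable_of_hasCompactSupport (by fun_prop) hcs
      rw [hg, integrable_indicator_iff (hmS ε)]
      refine hi.integrableOn.bdd_smul (|transformConst N| * (1 / ε ^ N))
        hkm.aestronglyMeasurable ?_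
      refine (ae_restrict_iff' (hmS ε)).2 (ae_of_all _ fun y hy => (hkb y).trans ?_)
      have hy' : ε < ‖y‖ := hy
      have h0 : 0 < ‖y‖ := hε.trans hy'
      have : ‖y‖ / ‖y‖ ^ (N + 1) = 1 / ‖y‖ ^ N := by
        field_simp
        ring
      rw [this]
      gcongr
    have hsum : S.indicator h = fun y => g y + g (-y) := by
      funext y
      by_cases hy : y ∈ S
      · have hy' : -y ∈ S := by simpa [hS] using hy
        simp only [hg, Set.indicator_of_mem hy, Set.indicator_of_mem hy', hh, hodd,
          sub_neg_eq_add, smul_sub, neg_smul]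
        rw [← sub_eq_add_neg]
      · have hy' : -y ∉ S := by simpa [hS] using hy
        simp [hg, Set.indicator_of_notMem hy, Set.indicator_of_notMem hy']
    rw [hsum, integral_add hgint hgint.comp_neg, integral_neg_eq_self g volume,
      hg, integral_indicator (hmS ε), ← two_smul ℝ, smul_smul]
    norm_num
    rfl
  refine ⟨(2⁻¹ : ℝ) • ∫ y, h y, ?_⟩
  have hlim : Tendsto (fun ε : ℝ => (2⁻¹ : ℝ) •
      ∫ y, {y : EuclideanSpace ℝ (Fin N) | ε < ‖y‖}.indicator h y) (𝓝[>] (0 : ℝ))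
      (𝓝 ((2⁻¹ : ℝ) • ∫ y, h y)) := by
    refine Tendsto.const_smul (tendsto_integral_filter_of_dominated_convergence (fun y => ‖h y‖)
      (Eventually.of_forall fun ε => hhm.indicator (hmS ε))
      (Eventually.of_forall fun ε => ae_of_all _ fun y => norm_indicator_le_norm_self h y)
      hint.norm (ae_of_all _ fun y => ?_)) _
    by_cases hy : y = 0
    · subst hy
      have h0 : h 0 = 0 := by simp [hh]
      have : ∀ ε : ℝ, {y : EuclideanSpace ℝ (Fin N) | ε < ‖y‖}.indicator h 0 = 0 := fun ε => by
        rw [Set.indicator_apply, h0, ite_self]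
      simp only [this, h0]
      exact tendsto_const_nhds
    · refine tendsto_const_nhds.congr' ?_
      have : Set.Ioo (0 : ℝ) ‖y‖ ∈ 𝓝[>] (0 : ℝ) := Ioo_mem_nhdsGT (norm_pos_iff.2 hy)
      filter_upwards [this] with ε hε
      exact (Set.indicator_of_mem (show y ∈ {y | ε < ‖y‖} from hε.2) h).symm
  refine hlim.congr' ?_
  filter_upwards [self_mem_nhdsWithin] with ε hε
  exact (key ε hε).symm

/-- The vector Riesz transform `R u = (R_1 u, …, R_N u)`, with values in `𝕜^N` with its
Euclidean norm. -/
def vectorRiesz {𝕜 : Type*} [RCLike 𝕜] {N : ℕ}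
    (u : EuclideanSpace ℝ (Fin N) → 𝕜) (x : EuclideanSpace ℝ (Fin N)) :
    EuclideanSpace 𝕜 (Fin N) :=
  WithLp.toLp 2 fun j => rieszTransform j u x

end

end SteinWeiss

/-! For test functions $R_ju=\frac{c_N}{1-N}|\cdot|^{1-N}*\partial_ju$, so $Ru$ is a gradient and is
curl free. The potential is recovered from it by $I_\ell u=C\sum_jK_j*R_ju$ with
$K_j(z)=z_j|z|^{\ell-N-1}$ (`exists_rieszPotential_eq_sum`). No Fourier transform is used: symmetry
and scaling force the convolution of $z|z|^{\ell-N-1}$ with $|z|^{1-N}$, suitably symmetrised, to be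
a multiple of $y|y|^{\ell-N}$, and Euler's identity turns $\int|y|^{\ell-N}\,Du(x-y)y\,dy$ into
$\ell\int|y|^{\ell-N}u(x-y)\,dy$.

Since $|K_j(z)|\le|z|^{\ell-N}$, an $L^1\to L^q$ bound would follow from a uniform bound in $y$ for
the $L^q$ norm in $x$ of $|x|^{-\beta}|x-y|^{\ell-N}|y|^{-\alpha}$. For $\alpha\ge0$ this norm
diverges as $|x|\to\infty$, so one order of decay has to be gained where $|y|\ll|x|$. There $K_j(x)$
is subtracted from $K_j(x-y)$, cut off at scale $|x|$, which leaves `cancelledKernel`. Its weighted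
norm is finite exactly because $\alpha<1$.

The subtracted term is $K_j(x)\int\varphi(y/|x|)R_ju(y)\,dy$. Testing the curl-free condition
against $y_k\varphi(y/|x|)$ with $k\ne j$ bounds this mean by the integral of $|Ru|$ over an annulus
$|y|\sim|x|$ (`exists_enorm_integral_cutoff_smul_rieszTransform_le`), where the uncancelled kernel
is already of size $|x|^{\ell-N}$. -/

namespace SteinWeiss

/-! ### Integrability and homogeneity of powers of the norm. -/

section Powers

variable {E : Type*} [NormedAddCommGroup E] [InnerProductSpace ℝ E] [FiniteDimensional ℝ E]
  [MeasurableSpace E] [BorelSpace E]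

theorem locallyIntegrable_norm_rpow (hd : 1 ≤ Module.finrank ℝ E) {s : ℝ}
    (hs : -(Module.finrank ℝ E : ℝ) < s) :
    LocallyIntegrable (fun z : E => ‖z‖ ^ s) volume := by
  refine locallyIntegrable_of_norm_le_rpow (C := 1) (α := -s) hd (by linarith)
    (ae_of_all _ fun x => ?_) (by fun_prop : Measurable _).aestronglyMeasurable
  rw [neg_neg, one_mul, Real.norm_of_nonneg (by positivity)]

theorem integrableOn_norm_rpow_one_le {s : ℝ} (hs : s < -(Module.finrank ℝ E : ℝ)) :
    IntegrableOn (fun z : E => ‖z‖ ^ s) {z | 1 ≤ ‖z‖} volume := by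
  have hs0 : s ≤ 0 := by
    have : (0 : ℝ) ≤ Module.finrank ℝ E := by positivity
    linarith
  have h := (integrable_one_add_norm (E := E) (μ := volume) (r := -s) (by linarith)).const_mul
    ((2 : ℝ) ^ (-s))
  refine Integrable.mono' h.integrableOn (by fun_prop : Measurable _).aestronglyMeasurable ?_
  refine (ae_restrict_iff' (measurableSet_le measurable_const measurable_norm)).2
    (ae_of_all _ fun z hz => ?_)
  have hz : 1 ≤ ‖z‖ := hz
  rw [Real.norm_of_nonneg (by positivity), neg_neg]
  have h1 : (2 : ℝ) ^ (-s) * (1 + ‖z‖) ^ s = ((1 + ‖z‖) / 2) ^ s := by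
    rw [Real.div_rpow (by positivity) (by positivity), Real.rpow_neg (by positivity)]
    field_simp
  rw [h1]
  exact Real.rpow_le_rpow_of_nonpos (by positivity) (by linarith) hs0

theorem rpow_le_of_mem_Icc {a b x : ℝ} (ha : 0 < a) (hax : a ≤ x) (hxb : x ≤ b) (s : ℝ) :
    x ^ s ≤ a ^ s + b ^ s := by
  have hx : 0 < x := ha.trans_le hax
  have hb : 0 < b := hx.trans_le hxb
  rcases le_total 0 s with h | h
  · have := Real.rpow_le_rpow hx.le hxb h
    have := Real.rpow_nonneg ha.le s
    linarith
  · have := Real.rpow_le_rpow_of_nonpos ha hax h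
    have := Real.rpow_nonneg hb.le s
    linarith

/-- Two integrable power singularities at different points. -/
theorem integrableOn_norm_rpow_mul_norm_sub_rpow (hd : 1 ≤ Module.finrank ℝ E) {s t : ℝ}
    (hs : -(Module.finrank ℝ E : ℝ) < s) (ht : -(Module.finrank ℝ E : ℝ) < t) {e : E}
    (he : ‖e‖ = 1) (R : ℝ) :
    IntegrableOn (fun z : E => ‖z‖ ^ s * ‖z - e‖ ^ t) (Metric.closedBall 0 R) volume := by
  have h1 : IntegrableOn (fun z : E => ‖z‖ ^ s) (Metric.closedBall 0 R) volume :=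
    (locallyIntegrable_norm_rpow hd hs).integrableOn_isCompact (isCompact_closedBall _ _)
  have h2 : IntegrableOn (fun z : E => ‖z - e‖ ^ t) (Metric.closedBall 0 R) volume := by
    have hc : IntegrableOn (fun z : E => ‖z‖ ^ t) (Metric.closedBall 0 (R + 1)) volume :=
      (locallyIntegrable_norm_rpow hd ht).integrableOn_isCompact (isCompact_closedBall _ _)
    have := hc.integrable_indicator Metric.isClosed_closedBall.measurableSet
    have := (this.comp_sub_right e).integrableOn (s := Metric.closedBall 0 R)
    refine this.congr_fun (fun z hz => ?_) Metric.isClosed_closedBall.measurableSet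
    rw [mem_closedBall_zero_iff] at hz
    refine Set.indicator_of_mem ?_ _
    rw [mem_closedBall_zero_iff]
    calc ‖z - e‖ ≤ ‖z‖ + ‖e‖ := norm_sub_le _ _
      _ ≤ R + 1 := by linarith
  -- As `‖e‖ = 1`, at each point one of `‖z‖`, `‖z - e‖` is at least `1 / 2`. That factor is bounded
  -- by `|A|` or `|B|`, and the other one is integrable.
  set A : ℝ := (1 / 2 : ℝ) ^ s + R ^ s with hA
  set B : ℝ := (1 / 2 : ℝ) ^ t + (R + 1) ^ t with hB
  refine Integrable.mono' ((h1.const_mul |B|).add (h2.const_mul |A|)) (by fun_prop) ?_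
  refine (ae_restrict_iff' Metric.isClosed_closedBall.measurableSet).2 (ae_of_all _ fun z hz => ?_)
  rw [mem_closedBall_zero_iff] at hz
  rw [Real.norm_of_nonneg (by positivity)]
  simp only [Pi.add_apply]
  have hp1 : 0 ≤ ‖z‖ ^ s := by positivity
  have hp2 : 0 ≤ ‖z - e‖ ^ t := by positivity
  have hle : ‖z - e‖ ≤ R + 1 := by
    have := norm_sub_le z e
    linarith
  rcases le_total (1 / 2) ‖z‖ with h | h
  · have h3 : ‖z‖ ^ s ≤ |A| :=
      (rpow_le_of_mem_Icc (by norm_num) h hz s).trans (le_abs_self _)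
    have h4 := mul_le_mul_of_nonneg_right h3 hp2
    have h5 := mul_nonneg (abs_nonneg B) hp1
    linarith
  · have h' : 1 / 2 ≤ ‖z - e‖ := by
      have := norm_sub_norm_le e z
      rw [norm_sub_rev] at this
      linarith
    have h3 : ‖z - e‖ ^ t ≤ |B| :=
      (rpow_le_of_mem_Icc (by norm_num) h' hle t).trans (le_abs_self _)
    have h4 := mul_le_mul_of_nonneg_left h3 hp1
    have h5 := mul_nonneg (abs_nonneg A) hp2
    linarith

theorem abs_rpow_sub_rpow_le {s m a b : ℝ} (hs : s ≤ 1) (hm : 0 < m) (ha : m ≤ a) (hb : m ≤ b) :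
    |a ^ s - b ^ s| ≤ |s| * m ^ (s - 1) * |a - b| := by
  have := (convex_Ici m).norm_image_sub_le_of_norm_hasDerivWithin_le
    (f := fun x : ℝ => x ^ s) (f' := fun x => s * x ^ (s - 1)) (C := |s| * m ^ (s - 1))
    (x := b) (y := a)
    (fun x hx => (Real.hasDerivAt_rpow_const (Or.inl (hm.trans_le hx).ne')).hasDerivWithinAt)
    (fun x hx => ?_) hb ha
  · simpa using this
  · have hx' : m ≤ x := hx
    rw [norm_mul, Real.norm_eq_abs, Real.norm_of_nonneg (Real.rpow_nonneg (hm.le.trans hx') _)]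
    exact mul_le_mul_of_nonneg_left
      (Real.rpow_le_rpow_of_nonpos hm hx' (by linarith)) (abs_nonneg _)

theorem lintegral_comp_smul {t : ℝ} (ht : 0 < t) (f : E → ENNReal) :
    ∫⁻ z, f (t • z) = ENNReal.ofReal (t ^ (-(Module.finrank ℝ E : ℝ))) * ∫⁻ z, f z := by
  have h := lintegral_map_equiv (μ := volume) f
    (Homeomorph.smulOfNeZero t ht.ne' : E ≃ₜ E).toMeasurableEquiv
  have h' : Measure.map ((Homeomorph.smulOfNeZero t ht.ne' : E ≃ₜ E).toMeasurableEquiv) volume =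
      ENNReal.ofReal |(t ^ Module.finrank ℝ E)⁻¹| • (volume : Measure E) :=
    Measure.map_addHaar_smul volume ht.ne'
  rw [h', lintegral_smul_measure, abs_of_pos (by positivity), ← Real.rpow_natCast,
    ← Real.rpow_neg ht.le] at h
  exact h.symm

/-- The integral of a rotation invariant homogeneous kernel is homogeneous. -/
theorem lintegral_eq_of_homogeneous {f : E → E → ENNReal} {r : ℝ}
    (hA : ∀ (A : E ≃ₗᵢ[ℝ] E) w z, f (A w) (A z) = f w z)
    (ht : ∀ t : ℝ, 0 < t → ∀ w z, f (t • w) (t • z) = ENNReal.ofReal (t ^ r) * f w z)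
    {e w : E} (he : ‖e‖ = 1) (hw : w ≠ 0) :
    ∫⁻ z, f w z = ENNReal.ofReal (‖w‖ ^ (r + Module.finrank ℝ E)) * ∫⁻ z, f e z := by
  have hw0 : 0 < ‖w‖ := norm_pos_iff.2 hw
  -- Two vectors of equal norm are exchanged by the reflection in the hyperplane orthogonal to their
  -- difference.
  obtain ⟨A, hAe⟩ : ∃ A : E ≃ₗᵢ[ℝ] E, A e = ‖w‖⁻¹ • w := ⟨_, Submodule.reflection_sub (by
    rw [he, norm_smul, norm_inv, norm_norm, inv_mul_cancel₀ hw0.ne'])⟩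
  have h1 : ∫⁻ z, f (‖w‖⁻¹ • w) z = ∫⁻ z, f e z := by
    rw [← A.measurePreserving.lintegral_comp_emb A.toMeasurableEquiv.measurableEmbedding]
    simp_rw [← hAe, hA]
  have h2 := lintegral_comp_smul (inv_pos.2 hw0) (fun z => f (‖w‖⁻¹ • w) z)
  simp_rw [ht _ (inv_pos.2 hw0), h1] at h2
  rw [lintegral_const_mul' _ _ ENNReal.ofReal_ne_top] at h2
  have h3 : ENNReal.ofReal (‖w‖ ^ r) * ENNReal.ofReal (‖w‖⁻¹ ^ r) = 1 := by
    rw [← ENNReal.ofReal_mul (by positivity), ← Real.mul_rpow (by positivity) (by positivity),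
      mul_inv_cancel₀ hw0.ne', Real.one_rpow, ENNReal.ofReal_one]
  calc ∫⁻ z, f w z = ENNReal.ofReal (‖w‖ ^ r) *
        (ENNReal.ofReal (‖w‖⁻¹ ^ r) * ∫⁻ z, f w z) := by rw [← mul_assoc, h3, one_mul]
    _ = _ := by
      rw [h2, ← mul_assoc, ← ENNReal.ofReal_mul (by positivity), Real.inv_rpow hw0.le,
        Real.rpow_neg hw0.le, inv_inv, ← Real.rpow_add hw0]

end Powers

/-! ### Integration by parts in convolutions. -/

section Convolution

variable {E G : Type*} [NormedAddCommGroup E] [MeasurableSpace E] [BorelSpace E]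
  [NormedAddCommGroup G] [NormedSpace ℝ G] {μ : Measure E}

theorem integrable_smul_comp_sub {f : E → ℝ} {g : E → G} (hf : LocallyIntegrable f μ)
    (hg : Continuous g) (hc : HasCompactSupport g) (x : E) :
    Integrable (fun y => f y • g (x - y)) μ :=
  hc.convolutionExists_right (ContinuousLinearMap.lsmul ℝ ℝ) hf hg x

variable [NormedSpace ℝ E] [FiniteDimensional ℝ E] [μ.IsAddHaarMeasure]

/-- Integration by parts against a Lipschitz function. -/
theorem integral_lineDeriv_smul_comp_sub [CompleteSpace G] {C : NNReal} {f : E → ℝ}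
    (hf : LipschitzWith C f) {g : E → G} (hg : ContDiff ℝ 1 g) (hc : HasCompactSupport g)
    (x v : E) :
    ∫ y, lineDeriv ℝ f y v • g (x - y) ∂μ = ∫ y, f y • fderiv ℝ g (x - y) v ∂μ := by
  have hg' : Continuous fun y => fderiv ℝ g y v := by
    have := hg.continuous_fderiv one_ne_zero
    fun_prop
  -- Continuous functionals reduce the identity to real-valued functions.
  refine (SeparatingDual.eq_iff_forall_dual_eq (R := ℝ)).2 fun L => ?_
  rw [← L.integral_comp_comm, ← L.integral_comp_comm]
  · simp only [map_smul, smul_eq_mul]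
    have hcs : HasCompactSupport fun y => L (g (x - y)) := by
      have := hc.comp_homeomorph (Homeomorph.subLeft x)
      exact this.comp_left (g := L) (map_zero L)
    have hcd : ContDiff ℝ 1 fun y => L (g (x - y)) := by fun_prop
    obtain ⟨D, hD⟩ := hcd.lipschitzWith_of_hasCompactSupport hcs one_ne_zero
    rw [hf.integral_lineDeriv_mul_eq hD hcs]
    congr 1 with y
    rw [mul_comm]
    congr 1
    have h1 : HasFDerivAt (fun y => x - y) (-ContinuousLinearMap.id ℝ E) y := by
      simpa using (hasFDerivAt_id y).const_sub x
    have h2 : HasFDerivAt g (fderiv ℝ g (x - y)) (x - y) :=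
      (hg.differentiable one_ne_zero _).hasFDerivAt
    -- The direction `-v` carries the sign of the integration by parts; it cancels the sign from
    -- differentiating `x - y`.
    have h3 := (L.hasFDerivAt.comp y (h2.comp y h1)).hasLineDerivAt (-v)
    exact h3.lineDeriv.trans (by simp)
  · exact integrable_smul_comp_sub hf.continuous.locallyIntegrable hg'
      (hc.fderiv_apply (𝕜 := ℝ) v) x
  · exact integrable_smul_comp_sub (hf.locallyIntegrable_lineDeriv v) hg.continuous hc x

end Convolution

/-! ### The power of the norm, made constant near the origin. -/

section Truncation

variable {E : Type*} [NormedAddCommGroup E]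

theorem lipschitzWith_max_norm_rpow {s ε : ℝ} (hs : s ≤ 1) (hε : 0 < ε) :
    LipschitzWith (Real.toNNReal (|s| * ε ^ (s - 1))) fun y : E => (max ‖y‖ ε) ^ s := by
  refine LipschitzWith.of_dist_le_mul fun x y => ?_
  rw [Real.coe_toNNReal _ (by positivity), Real.dist_eq]
  refine (abs_rpow_sub_rpow_le hs hε (le_max_right _ _) (le_max_right _ _)).trans ?_
  refine mul_le_mul_of_nonneg_left ?_ (by positivity)
  refine (abs_max_sub_max_le_abs _ _ _).trans ?_
  rw [dist_eq_norm]
  exact abs_norm_sub_norm_le x y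

variable [InnerProductSpace ℝ E]

theorem lineDeriv_max_norm_rpow_of_lt {s ε : ℝ} (hε : 0 < ε) {y : E} (hy : ε < ‖y‖) (v : E) :
    lineDeriv ℝ (fun y : E => (max ‖y‖ ε) ^ s) y v = s * (inner ℝ y v * ‖y‖ ^ (s - 2)) := by
  have hy0 : 0 < ‖y‖ := hε.trans hy
  have h1 : HasDerivAt (fun t : ℝ => y + t • v) v 0 := by
    simpa using ((hasDerivAt_id (0 : ℝ)).smul_const v).const_add y
  have h2 := (h1.norm_sq.rpow_const (p := s / 2) (Or.inl (by simpa using hy0.ne')))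
  have h3 : (fun t : ℝ => (max ‖y + t • v‖ ε) ^ s) =ᶠ[𝓝 0]
      fun t : ℝ => (‖y + t • v‖ ^ 2) ^ (s / 2) := by
    have hc : ContinuousAt (fun t : ℝ => ‖y + t • v‖) 0 := by fun_prop
    have : ∀ᶠ t : ℝ in 𝓝 0, ε < ‖y + t • v‖ := hc.eventually (lt_mem_nhds (by simpa using hy))
    filter_upwards [this] with t ht
    rw [max_eq_left ht.le, ← Real.rpow_natCast, ← Real.rpow_mul (norm_nonneg _)]
    congr 1
    push_cast
    ring
  have h4 := (h2.congr_of_eventuallyEq h3).deriv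
  rw [lineDeriv, h4]
  simp only [zero_smul, add_zero]
  rw [← Real.rpow_natCast, ← Real.rpow_mul (norm_nonneg _)]
  have : ((2 : ℕ) : ℝ) * (s / 2 - 1) = s - 2 := by push_cast; ring
  rw [this]
  ring

theorem lineDeriv_max_norm_rpow_of_gt {s ε : ℝ} {y : E} (hy : ‖y‖ < ε) (v : E) :
    lineDeriv ℝ (fun y : E => (max ‖y‖ ε) ^ s) y v = 0 := by
  have h3 : (fun t : ℝ => (max ‖y + t • v‖ ε) ^ s) =ᶠ[𝓝 0] fun _ : ℝ => ε ^ s := by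
    have hc : ContinuousAt (fun t : ℝ => ‖y + t • v‖) 0 := by fun_prop
    have : ∀ᶠ t : ℝ in 𝓝 0, ‖y + t • v‖ < ε := hc.eventually (gt_mem_nhds (by simpa using hy))
    filter_upwards [this] with t ht
    rw [max_eq_right ht.le]
  rw [lineDeriv, h3.deriv_eq, deriv_const]

end Truncation

/-! ### The Riesz transform as a gradient. -/

section Transform

variable {𝕜 : Type*} [RCLike 𝕜] {N : ℕ}

/-- Away from the origin $G_j=\frac{c_N}{1-N}\partial_j|y|^{1-N}$. Freezing the power inside the
ball of radius $\varepsilon$ keeps it Lipschitz, and its derivative is almost everywhere the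
truncated kernel, so integration by parts leaves no boundary term. -/
theorem truncatedRiesz_eq (hN : 2 ≤ N) (j : Fin N) {u : EuclideanSpace ℝ (Fin N) → 𝕜}
    (hu : ContDiff ℝ 1 u) (hc : HasCompactSupport u) (x : EuclideanSpace ℝ (Fin N))
    {ε : ℝ} (hε : 0 < ε) :
    truncatedRiesz j u x ε = (transformConst N / (1 - N)) •
      ∫ y, (max ‖y‖ ε) ^ (1 - (N : ℝ)) • fderiv ℝ u (x - y) (EuclideanSpace.single j 1) := by
  have hN' : (2 : ℝ) ≤ N := by exact_mod_cast hN
  have : Nontrivial (EuclideanSpace ℝ (Fin N)) :=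
    Module.nontrivial_of_finrank_pos (R := ℝ) (by simp; omega)
  rw [← integral_lineDeriv_smul_comp_sub (lipschitzWith_max_norm_rpow (by linarith) hε) hu hc,
    ← integral_smul, truncatedRiesz, ← integral_indicator
      (measurableSet_lt measurable_const measurable_norm)]
  refine integral_congr_ae ?_
  have hsph : ∀ᵐ y : EuclideanSpace ℝ (Fin N), y ∉ Metric.sphere 0 ε :=
    measure_eq_zero_iff_ae_notMem.1 (Measure.addHaar_sphere volume 0 ε)
  filter_upwards [hsph] with y hy
  rw [mem_sphere_zero_iff_norm] at hy
  rcases lt_or_gt_of_ne hy with h | h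
  · rw [lineDeriv_max_norm_rpow_of_gt h, Set.indicator_of_notMem (by simpa using h.le)]
    simp
  · rw [lineDeriv_max_norm_rpow_of_lt hε h, Set.indicator_of_mem (by simpa using h), smul_smul]
    congr 1
    have h0 : 0 < ‖y‖ := hε.trans h
    have h1 : (1 : ℝ) - N ≠ 0 := by linarith
    have h2 : ‖y‖ ^ (1 - (N : ℝ) - 2) = 1 / ‖y‖ ^ (N + 1) := by
      rw [show 1 - (N : ℝ) - 2 = -((N + 1 : ℕ) : ℝ) by push_cast; ring, Real.rpow_neg h0.le,
        Real.rpow_natCast, one_div]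
    have h3 : inner ℝ y (EuclideanSpace.single j (1 : ℝ)) = y j := by
      simp [EuclideanSpace.inner_single_right]
    rw [h2, h3, rieszKernel]
    field_simp

/-- Let $\varepsilon\to0$ in `truncatedRiesz_eq`. The frozen powers are dominated by $|y|^{1-N}$,
which is locally integrable. -/
theorem rieszTransform_eq (hN : 2 ≤ N) (j : Fin N) {u : EuclideanSpace ℝ (Fin N) → 𝕜}
    (hu : ContDiff ℝ ∞ u) (hc : HasCompactSupport u) (x : EuclideanSpace ℝ (Fin N)) :
    rieszTransform j u x = (transformConst N / (1 - N)) •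
      ∫ y, ‖y‖ ^ (1 - (N : ℝ)) • fderiv ℝ u (x - y) (EuclideanSpace.single j 1) := by
  have hN' : (2 : ℝ) ≤ N := by exact_mod_cast hN
  have : Nontrivial (EuclideanSpace ℝ (Fin N)) :=
    Module.nontrivial_of_finrank_pos (R := ℝ) (by simp; omega)
  refine tendsto_nhds_unique (tendsto_truncatedRiesz j hu hc x) ?_
  have hu' : Continuous fun y => fderiv ℝ u y (EuclideanSpace.single j 1) := by
    have := hu.continuous_fderiv (by simp)
    fun_prop
  have hint : Integrable (fun y => ‖y‖ ^ (1 - (N : ℝ)) •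
      fderiv ℝ u (x - y) (EuclideanSpace.single j 1)) :=
    integrable_smul_comp_sub
      (locallyIntegrable_norm_rpow (by simp; omega) (by simp)) hu'
      (hc.fderiv_apply (𝕜 := ℝ) _) x
  have key : Tendsto (fun ε : ℝ => ∫ y, (max ‖y‖ ε) ^ (1 - (N : ℝ)) •
      fderiv ℝ u (x - y) (EuclideanSpace.single j 1)) (𝓝[>] (0 : ℝ))
      (𝓝 (∫ y, ‖y‖ ^ (1 - (N : ℝ)) • fderiv ℝ u (x - y) (EuclideanSpace.single j 1))) := by
    have hne : ∀ᵐ y : EuclideanSpace ℝ (Fin N), y ≠ 0 :=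
      measure_eq_zero_iff_ae_notMem.1 (measure_singleton 0)
    refine tendsto_integral_filter_of_dominated_convergence _ ?_ ?_ hint.norm ?_
    · refine Eventually.of_forall fun ε => ?_
      refine (by fun_prop : Measurable fun y : EuclideanSpace ℝ (Fin N) =>
        (max ‖y‖ ε) ^ (1 - (N : ℝ))).aestronglyMeasurable.smul ?_
      exact (hu'.comp (continuous_const.sub continuous_id)).aestronglyMeasurable
    · filter_upwards with ε
      filter_upwards [hne] with y hy
      rw [norm_smul, norm_smul]
      refine mul_le_mul_of_nonneg_right ?_ (norm_nonneg _)
      have h0 : 0 < ‖y‖ := norm_pos_iff.2 hy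
      rw [Real.norm_of_nonneg (by positivity), Real.norm_of_nonneg (by positivity)]
      exact Real.rpow_le_rpow_of_nonpos h0 (le_max_left _ _) (by linarith)
    · filter_upwards [hne] with y hy
      refine tendsto_const_nhds.congr' ?_
      filter_upwards [Ioo_mem_nhdsGT (norm_pos_iff.2 hy)] with ε hε
      rw [max_eq_left hε.2.le]
  refine (key.const_smul _).congr' ?_
  filter_upwards [self_mem_nhdsWithin] with ε hε
  exact (truncatedRiesz_eq hN j (hu.of_le (by simp)) hc x hε).symm

/-- The vector Riesz transform of a test function is a gradient. -/
theorem exists_fderiv_eq_rieszTransform (hN : 2 ≤ N) {u : EuclideanSpace ℝ (Fin N) → 𝕜}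
    (hu : ContDiff ℝ ∞ u) (hc : HasCompactSupport u) :
    ∃ v : EuclideanSpace ℝ (Fin N) → 𝕜, ContDiff ℝ 1 v ∧
      ∀ j x, fderiv ℝ v x (EuclideanSpace.single j 1) = rieszTransform j u x := by
  have hk : LocallyIntegrable (fun y : EuclideanSpace ℝ (Fin N) => ‖y‖ ^ (1 - (N : ℝ))) volume :=
    locallyIntegrable_norm_rpow (by simp; omega) (by simp)
  have hu1 : ContDiff ℝ 1 u := hu.of_le (by simp)
  set L : ℝ →L[ℝ] 𝕜 →L[ℝ] 𝕜 := ContinuousLinearMap.lsmul ℝ ℝ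
  refine ⟨fun x => (transformConst N / (1 - N)) •
    convolution (fun y => ‖y‖ ^ (1 - (N : ℝ))) u L volume x,
    (hc.contDiff_convolution_right (n := 1) L hk hu1).const_smul _, fun j x => ?_⟩
  have hd : HasFDerivAt (fun x => (transformConst N / (1 - N)) •
    convolution (fun y => ‖y‖ ^ (1 - (N : ℝ))) u L volume x) _ x :=
    (hc.hasFDerivAt_convolution_right L hk hu1 x).const_smul (transformConst N / (1 - (N : ℝ)))
  rw [hd.fderiv, smul_apply,
    convolution_precompR_apply L hk (hc.fderiv ℝ) (hu1.continuous_fderiv one_ne_zero),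
    rieszTransform_eq hN j hu hc x]
  rfl

theorem continuous_rieszTransform (hN : 2 ≤ N) {u : EuclideanSpace ℝ (Fin N) → 𝕜}
    (hu : ContDiff ℝ ∞ u) (hc : HasCompactSupport u) (j : Fin N) :
    Continuous (rieszTransform j u) := by
  obtain ⟨v, hv, hvj⟩ := exists_fderiv_eq_rieszTransform hN hu hc
  have := hv.continuous_fderiv one_ne_zero
  rw [show rieszTransform j u = fun x => fderiv ℝ v x (EuclideanSpace.single j 1) from
    funext fun x => (hvj j x).symm]
  fun_prop

/-- The vector Riesz transform is curl free in the sense of distributions. -/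
theorem integral_fderiv_smul_rieszTransform_comm (hN : 2 ≤ N)
    {u : EuclideanSpace ℝ (Fin N) → 𝕜} (hu : ContDiff ℝ ∞ u) (hc : HasCompactSupport u)
    {ψ : EuclideanSpace ℝ (Fin N) → ℝ} (hψ : ContDiff ℝ ∞ ψ) (hψc : HasCompactSupport ψ)
    (j k : Fin N) :
    ∫ y, fderiv ℝ ψ y (EuclideanSpace.single j 1) • rieszTransform k u y =
      ∫ y, fderiv ℝ ψ y (EuclideanSpace.single k 1) • rieszTransform j u y := by
  obtain ⟨v, hv, hvj⟩ := exists_fderiv_eq_rieszTransform hN hu hc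
  have hψ1 : ContDiff ℝ ∞ (fderiv ℝ ψ) := hψ.fderiv_right (by simp)
  have hψ2 : Continuous (fderiv ℝ (fderiv ℝ ψ)) := hψ1.continuous_fderiv (by simp)
  have hsnd : ∀ y a b : EuclideanSpace ℝ (Fin N),
      fderiv ℝ (fun y => fderiv ℝ ψ y a) y b = fderiv ℝ (fderiv ℝ ψ) y b a := fun y a b => by
    rw [fderiv_clm_apply (hψ1.differentiable (by simp) y) (by fun_prop)]
    simp
  -- The potential `v` is only known to be $C^1$, so its derivative is moved to `ψ`, whose second
  -- derivative is symmetric.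
  have key : ∀ a b : EuclideanSpace ℝ (Fin N), ∫ y, fderiv ℝ ψ y a • fderiv ℝ v y b =
      - ∫ y, fderiv ℝ (fderiv ℝ ψ) y b a • v y := fun a b => by
    have hca := hψc.fderiv_apply (𝕜 := ℝ) a
    have hcab := hca.fderiv_apply (𝕜 := ℝ) b
    have hv' := hv.continuous_fderiv one_ne_zero
    have hva := hv.continuous
    have hψ' := hψ1.continuous
    have hd : ContDiff ℝ ∞ fun y => fderiv ℝ ψ y a := by fun_prop
    simp_rw [← hsnd]
    refine integral_smul_fderiv_eq_neg_fderiv_smul_of_integrable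
      (Continuous.integrable_of_hasCompactSupport ?_ hcab.smul_right)
      (Continuous.integrable_of_hasCompactSupport ?_ hca.smul_right)
      (Continuous.integrable_of_hasCompactSupport ?_ hca.smul_right)
      (fun y _ => hd.differentiable (by simp) y) (fun y _ => hv.differentiable one_ne_zero y)
    · simp_rw [hsnd]
      fun_prop
    · fun_prop
    · fun_prop
  simp_rw [← hvj]
  rw [key, key]
  congr 2 with y
  have := (hψ.contDiffAt (x := y)).isSymmSndFDerivAt (by simpa using ENat.LEInfty.out)
  rw [this.eq]

end Transform

/-! ### Convolution of the vector kernel with $|z|^{1-d}$. -/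

section OddKernel

variable {E : Type*} [NormedAddCommGroup E] [InnerProductSpace ℝ E]

/-- Up to the factor `z`, the integrand of the convolution of the kernels `z |z|^{l-d-1}` and
`|z|^{1-d}`, symmetrised so that it is absolutely convergent for all `0 < l < d`. -/
noncomputable def oddKernel (l : ℝ) (w z : E) : ℝ :=
  ‖z‖ ^ (l - Module.finrank ℝ E - 1) *
    (‖w - z‖ ^ (1 - Module.finrank ℝ E : ℝ) - ‖w + z‖ ^ (1 - Module.finrank ℝ E : ℝ))

theorem oddKernel_map (l : ℝ) (A : E ≃ₗᵢ[ℝ] E) (w z : E) :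
    oddKernel l (A w) (A z) = oddKernel l w z := by
  simp only [oddKernel, ← map_sub, ← map_add, LinearIsometryEquiv.norm_map]

theorem oddKernel_smul (l : ℝ) {t : ℝ} (ht : 0 < t) (w z : E) :
    oddKernel l (t • w) (t • z) = t ^ (l - 2 * Module.finrank ℝ E) * oddKernel l w z := by
  simp only [oddKernel, ← smul_sub, ← smul_add, norm_smul, Real.norm_of_nonneg ht.le]
  rw [Real.mul_rpow ht.le (norm_nonneg _), Real.mul_rpow ht.le (norm_nonneg _),
    Real.mul_rpow ht.le (norm_nonneg _),
    show l - 2 * Module.finrank ℝ E = (l - Module.finrank ℝ E - 1) + (1 - Module.finrank ℝ E) by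
      ring, Real.rpow_add ht]
  ring

variable [FiniteDimensional ℝ E] [MeasurableSpace E] [BorelSpace E]

theorem measurable_oddKernel (l : ℝ) : Measurable fun p : E × E => oddKernel l p.1 p.2 := by
  unfold oddKernel
  fun_prop

/-- The singularities at $0$ and $\pm e$ have orders $l-d$ and $1-d$, both above $-d$. At infinity
the difference of powers is $O(|z|^{-d})$, one order better than each term, so the integrand is
$O(|z|^{l-2d})$, which is integrable for every $l<d$. -/
theorem integrable_oddKernel_smul_of_norm_eq_one (hd : 2 ≤ Module.finrank ℝ E) {l : ℝ}
    (hl0 : 0 < l) (hld : l < Module.finrank ℝ E) {e : E} (he : ‖e‖ = 1) :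
    Integrable (fun z => oddKernel l e z • z) volume := by
  have hd' : (2 : ℝ) ≤ Module.finrank ℝ E := by exact_mod_cast hd
  set d : ℝ := ((Module.finrank ℝ E : ℕ) : ℝ) with hdd
  have hmeas : Measurable fun z => oddKernel l e z • z :=
    ((measurable_oddKernel l).comp (measurable_const.prodMk measurable_id)).smul measurable_id
  have hnorm : ∀ z : E, z ≠ 0 → ‖oddKernel l e z • z‖ =
      ‖z‖ ^ (l - d) * |‖e - z‖ ^ (1 - d) - ‖e + z‖ ^ (1 - d)| := fun z hz => by
    have h0 : 0 < ‖z‖ := norm_pos_iff.2 hz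
    rw [norm_smul, oddKernel, norm_mul, Real.norm_of_nonneg (by positivity), ← hdd,
      Real.norm_eq_abs, Real.rpow_sub h0 _ 1, Real.rpow_one]
    field_simp
  rw [← integrableOn_univ, ← Set.union_compl_self (Metric.closedBall (0 : E) 2)]
  refine IntegrableOn.union ?_ ?_
  · have h1 := integrableOn_norm_rpow_mul_norm_sub_rpow (E := E) (s := l - d) (t := 1 - d)
      (by omega) (by linarith) (by linarith) he 2
    have h2 := integrableOn_norm_rpow_mul_norm_sub_rpow (E := E) (s := l - d) (t := 1 - d)
      (by omega) (by linarith) (by linarith) (e := -e) (by rwa [norm_neg]) 2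
    refine Integrable.mono' (h1.add h2) hmeas.aestronglyMeasurable (ae_of_all _ fun z => ?_)
    simp only [Pi.add_apply]
    rcases eq_or_ne z 0 with rfl | hz
    · rw [smul_zero, norm_zero]
      positivity
    · rw [hnorm z hz, ← mul_add, norm_sub_rev z e, sub_neg_eq_add, add_comm z e]
      refine mul_le_mul_of_nonneg_left ((abs_sub _ _).trans_eq ?_) (by positivity)
      rw [abs_of_nonneg (by positivity), abs_of_nonneg (by positivity)]
  · have hsub : (Metric.closedBall (0 : E) 2)ᶜ ⊆ {z | 1 ≤ ‖z‖} := fun z hz => by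
      rw [Set.mem_compl_iff, mem_closedBall_zero_iff, not_le] at hz
      exact (one_lt_two.trans hz).le
    have h1 := ((integrableOn_norm_rpow_one_le (E := E) (s := l - 2 * d)
      (by linarith)).mono_set hsub).const_mul (|1 - d| * 2 ^ d * 2)
    refine Integrable.mono' h1 hmeas.aestronglyMeasurable ?_
    refine (ae_restrict_iff' Metric.isClosed_closedBall.measurableSet.compl).2
      (ae_of_all _ fun z hz => ?_)
    rw [Set.mem_compl_iff, mem_closedBall_zero_iff, not_le] at hz
    have h0 : 0 < ‖z‖ := zero_lt_two.trans hz
    have ha : ‖z‖ / 2 ≤ ‖e - z‖ := by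
      have := norm_sub_norm_le z e
      rw [norm_sub_rev] at this
      linarith
    have hb : ‖z‖ / 2 ≤ ‖e + z‖ := by
      have := norm_sub_norm_le z (-e)
      rw [norm_neg, sub_neg_eq_add, add_comm] at this
      linarith
    have hab : |‖e - z‖ - ‖e + z‖| ≤ 2 := by
      have := abs_norm_sub_norm_le (z - e) (z + e)
      rw [show z - e - (z + e) = (-2 : ℝ) • e by module, norm_smul, he, norm_sub_rev,
        add_comm] at this
      simpa using this
    rw [hnorm z (norm_pos_iff.1 h0)]
    have h2 := abs_rpow_sub_rpow_le (s := 1 - d) (by linarith) (half_pos h0) ha hb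
    calc ‖z‖ ^ (l - d) * |‖e - z‖ ^ (1 - d) - ‖e + z‖ ^ (1 - d)|
        ≤ ‖z‖ ^ (l - d) * (|1 - d| * (‖z‖ / 2) ^ (1 - d - 1) * 2) := by
          refine mul_le_mul_of_nonneg_left (h2.trans ?_) (by positivity)
          exact mul_le_mul_of_nonneg_left hab (by positivity)
      _ = |1 - d| * 2 ^ d * 2 * ‖z‖ ^ (l - 2 * d) := by
          rw [show 1 - d - 1 = -d by ring, Real.div_rpow h0.le zero_le_two,
            Real.rpow_neg zero_le_two, show l - 2 * d = (l - d) + (-d) by ring, Real.rpow_add h0]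
          field_simp

theorem lintegral_oddKernel_smul (l : ℝ) {e w : E} (he : ‖e‖ = 1) (hw : w ≠ 0) :
    ∫⁻ z, ‖oddKernel l w z • z‖ₑ =
      ENNReal.ofReal (‖w‖ ^ (l + 1 - Module.finrank ℝ E)) * ∫⁻ z, ‖oddKernel l e z • z‖ₑ := by
  have h := lintegral_eq_of_homogeneous (E := E) (f := fun w z => ‖oddKernel l w z • z‖ₑ)
    (r := l - 2 * Module.finrank ℝ E + 1) (fun A w z => ?_) (fun t ht w z => ?_) he hw
  · rw [h]
    congr 3
    ring
  · rw [oddKernel_map, ← map_smul, A.enorm_map]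
  · have h1 : oddKernel l (t • w) (t • z) • t • z =
        (t ^ (l - 2 * Module.finrank ℝ E + 1)) • oddKernel l w z • z := by
      rw [oddKernel_smul l ht, smul_smul, smul_smul, Real.rpow_add_one ht.ne']
      congr 1
      ring
    simp only [h1]
    rw [enorm_smul, Real.enorm_of_nonneg (by positivity)]

theorem integrable_oddKernel_smul (hd : 2 ≤ Module.finrank ℝ E) {l : ℝ}
    (hl0 : 0 < l) (hld : l < Module.finrank ℝ E) (w : E) :
    Integrable (fun z => oddKernel l w z • z) volume := by
  have : Nontrivial E := Module.nontrivial_of_finrank_pos (R := ℝ) (by omega)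
  obtain ⟨e, he⟩ := exists_norm_eq E zero_le_one
  rcases eq_or_ne w 0 with rfl | hw
  · simp [oddKernel]
  · refine ⟨?_, ?_⟩
    · exact (((measurable_oddKernel l).comp
        (measurable_const.prodMk measurable_id)).smul measurable_id).aestronglyMeasurable
    · rw [HasFiniteIntegral, lintegral_oddKernel_smul l he hw]
      exact ENNReal.mul_lt_top ENNReal.ofReal_lt_top
        (integrable_oddKernel_smul_of_norm_eq_one hd hl0 hld he).2

theorem integral_oddKernel_smul_map (l : ℝ) (A : E ≃ₗᵢ[ℝ] E) (w : E) :
    ∫ z, oddKernel l (A w) z • z = A (∫ z, oddKernel l w z • z) := by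
  rw [← A.measurePreserving.integral_comp A.toMeasurableEquiv.measurableEmbedding]
  simp_rw [oddKernel_map, ← map_smul]
  exact A.toContinuousLinearEquiv.integral_comp_comm _

theorem integral_oddKernel_smul_smul (l : ℝ) {t : ℝ} (ht : 0 < t) (w : E) :
    ∫ z, oddKernel l (t • w) z • z =
      t ^ (l + 1 - Module.finrank ℝ E) • ∫ z, oddKernel l w z • z := by
  have h := Measure.integral_comp_smul volume (fun z => oddKernel l (t • w) z • z) t
  have h1 : ∀ z : E, oddKernel l (t • w) (t • z) • t • z =
      (t ^ (l - 2 * Module.finrank ℝ E + 1)) • oddKernel l w z • z := fun z => by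
    rw [oddKernel_smul l ht, smul_smul, smul_smul, Real.rpow_add_one ht.ne']
    congr 1
    ring
  simp_rw [h1] at h
  rw [integral_smul, abs_of_pos (by positivity), ← Real.rpow_natCast, ← Real.rpow_neg ht.le] at h
  have h2 := congrArg (fun v => t ^ (Module.finrank ℝ E : ℝ) • v) h
  simp only [smul_smul, ← Real.rpow_add ht] at h2
  rw [add_neg_cancel, Real.rpow_zero, one_smul] at h2
  rw [← h2]
  congr 2
  ring

/-- The kernel and $\langle e,z\rangle$ are both odd in $z$. Where $\langle e,z\rangle>0$ one has
$|e-z|<|e+z|$, so for almost every $z$ the two have the same sign. -/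
theorem integral_oddKernel_mul_inner_pos (hd : 2 ≤ Module.finrank ℝ E) {l : ℝ}
    (hl0 : 0 < l) (hld : l < Module.finrank ℝ E) {e : E} (he : ‖e‖ = 1) :
    0 < inner ℝ e (∫ z, oddKernel l e z • z) := by
  have hd' : (2 : ℝ) ≤ Module.finrank ℝ E := by exact_mod_cast hd
  have : Nontrivial E := Module.nontrivial_of_finrank_pos (R := ℝ) (by omega)
  have hi := integrable_oddKernel_smul hd hl0 hld e
  rw [← integral_inner hi]
  have hlt : ∀ a b : E, 0 < inner ℝ a b → ‖a - b‖ < ‖a + b‖ := fun a b hab => by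
    have h1 := norm_sub_sq_real a b
    have h2 := norm_add_sq_real a b
    exact lt_of_pow_lt_pow_left₀ 2 (norm_nonneg _) (by linarith)
  -- The point `e` is excluded because `0 ^ s = 0` for a negative real exponent, which spoils the
  -- sign there.
  have hpos : ∀ z, 0 < inner ℝ e z → z ≠ e → 0 < inner ℝ e (oddKernel l e z • z) := by
    intro z hz hze
    have h1 := hlt e z hz
    have h2 : 0 < ‖e - z‖ := norm_pos_iff.2 (sub_ne_zero.2 hze.symm)
    have h3 : z ≠ 0 := by
      rintro rfl
      simp at hz
    have h4 : 0 < ‖z‖ := norm_pos_iff.2 h3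
    have h5 := Real.rpow_lt_rpow_of_neg h2 h1 (z := 1 - Module.finrank ℝ E) (by linarith)
    rw [inner_smul_right, oddKernel]
    have := sub_pos.2 h5
    positivity
  rw [integral_pos_iff_support_of_nonneg_ae _ (hi.const_inner e)]
  · have hopen : IsOpen {z : E | 0 < inner ℝ e z ∧ z ≠ e} := by
      have h : IsOpen {z : E | 0 < inner ℝ e z} := isOpen_lt continuous_const (by fun_prop)
      exact h.inter isOpen_ne
    refine (hopen.measure_pos volume ⟨(2 : ℝ) • e, ?_, ?_⟩).trans_le (measure_mono ?_)
    · rw [inner_smul_right, real_inner_self_eq_norm_sq, he]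
      norm_num
    · intro h
      have := congrArg norm h
      rw [norm_smul, he] at this
      norm_num at this
    · exact fun z hz => (hpos z hz.1 hz.2).ne'
  · have h1 : ∀ᵐ z : E, z ≠ e := measure_eq_zero_iff_ae_notMem.1 (measure_singleton e)
    have h2 : ∀ᵐ z : E, z ≠ -e := measure_eq_zero_iff_ae_notMem.1 (measure_singleton (-e))
    filter_upwards [h1, h2] with z hz1 hz2
    rcases lt_trichotomy (inner ℝ e z) 0 with h | h | h
    · have h3 := hpos (-z) (by rw [inner_neg_right]; linarith) (by
        rintro rfl
        simp at hz2)
      have h4 : oddKernel l e (-z) = - oddKernel l e z := by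
        simp only [oddKernel, norm_neg, sub_neg_eq_add, ← sub_eq_add_neg]
        ring
      rw [h4, neg_smul_neg] at h3
      exact h3.le
    · simp [inner_smul_right, h]
    · exact (hpos z h hz1).le

/-- The integral commutes with linear isometries in $w$. At a unit vector $e$ it is therefore fixed
by the reflection in the line $\mathbb Re$, hence lies on that line. Isometries and scaling carry
this to every $w$. -/
theorem exists_integral_oddKernel_smul_eq (hd : 2 ≤ Module.finrank ℝ E) {l : ℝ}
    (hl0 : 0 < l) (hld : l < Module.finrank ℝ E) :
    ∃ C : ℝ, 0 < C ∧ ∀ w : E, ∫ z, oddKernel l w z • z =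
      (C * ‖w‖ ^ (l - Module.finrank ℝ E)) • w := by
  have : Nontrivial E := Module.nontrivial_of_finrank_pos (R := ℝ) (by omega)
  obtain ⟨e, he⟩ := exists_norm_eq E zero_le_one
  have hpos := integral_oddKernel_mul_inner_pos hd hl0 hld he
  have hmem : (ℝ ∙ e).reflection (∫ z, oddKernel l e z • z) = ∫ z, oddKernel l e z • z := by
    rw [← integral_oddKernel_smul_map, Submodule.reflection_mem_subspace_eq_self
      (Submodule.mem_span_singleton_self e)]
  obtain ⟨C, hC⟩ := Submodule.mem_span_singleton.1 ((Submodule.reflection_eq_self_iff _).1 hmem)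
  rw [← hC, inner_smul_right, real_inner_self_eq_norm_sq, he, one_pow, mul_one] at hpos
  refine ⟨C, hpos, fun w => ?_⟩
  rcases eq_or_ne w 0 with rfl | hw
  · simp [oddKernel]
  have hw0 : 0 < ‖w‖ := norm_pos_iff.2 hw
  obtain ⟨A, hAe⟩ : ∃ A : E ≃ₗᵢ[ℝ] E, A e = ‖w‖⁻¹ • w := ⟨_, Submodule.reflection_sub (by
    rw [he, norm_smul, norm_inv, norm_norm, inv_mul_cancel₀ hw0.ne'])⟩
  have hw' : w = ‖w‖ • A e := by
    rw [hAe, smul_smul, mul_inv_cancel₀ hw0.ne', one_smul]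
  conv_lhs => rw [hw']
  rw [integral_oddKernel_smul_smul l hw0, integral_oddKernel_smul_map, ← hC, map_smul, hAe,
    smul_smul, smul_smul, show l + 1 - (Module.finrank ℝ E : ℝ) = l - Module.finrank ℝ E + 1 by
      ring, Real.rpow_add_one hw0.ne']
  congr 1
  field_simp

end OddKernel

/-! ### Euler's identity. -/

section Euler

variable {E G : Type*} [NormedAddCommGroup E] [InnerProductSpace ℝ E] [FiniteDimensional ℝ E]
  [MeasurableSpace E] [BorelSpace E] [NormedAddCommGroup G] [NormedSpace ℝ G]

/-- Euler's identity for convolution with the homogeneous kernel `|y|^{l-d}`. -/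
theorem integral_norm_rpow_smul_fderiv_apply_self (hd : 1 ≤ Module.finrank ℝ E) {l : ℝ}
    (hl : 0 < l) {u : E → G} (hu : ContDiff ℝ 1 u) (hc : HasCompactSupport u) (x : E) :
    ∫ y, ‖y‖ ^ (l - Module.finrank ℝ E) • fderiv ℝ u (x - y) y =
      l • ∫ y, ‖y‖ ^ (l - Module.finrank ℝ E) • u (x - y) := by
  set d : ℝ := ((Module.finrank ℝ E : ℕ) : ℝ) with hdd
  have hk : LocallyIntegrable (fun y : E => ‖y‖ ^ (l - d)) volume :=
    locallyIntegrable_norm_rpow hd (by linarith)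
  have hu' : Continuous (fderiv ℝ u) := hu.continuous_fderiv one_ne_zero
  obtain ⟨M, hM⟩ := (hc.fderiv ℝ).exists_bound_of_continuous hu'
  obtain ⟨r, hr⟩ := (hc.fderiv ℝ).isCompact.isBounded.subset_ball (0 : E)
  have hzero : ∀ y : E, r + ‖x‖ ≤ ‖y‖ → fderiv ℝ u (x - y) = 0 := by
    intro y hy
    by_contra hne
    have h1 := hr (subset_tsupport _ (Function.mem_support.2 hne))
    rw [mem_ball_zero_iff] at h1
    have h2 := norm_sub_norm_le y x
    rw [norm_sub_rev y x] at h2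
    linarith
  -- For `t > 1 / 2` and `‖y‖ > R` the point `x - t • y` lies outside the support, which gives a
  -- dominating function independent of `t`.
  set R : ℝ := 2 * (r + ‖x‖) with hR
  have hkm : AEStronglyMeasurable (fun y : E => ‖y‖ ^ (l - d)) volume :=
    hk.aestronglyMeasurable
  -- The integral of $|y|^{l-d}u(x-ty)$ equals $t^{-l}$ times its value at $t=1$. The identity comes
  -- from computing its derivative at $t=1$ both under the integral sign and from this formula.
  have hderiv := hasDerivAt_integral_of_dominated_loc_of_deriv_le (μ := (volume : Measure E))
    (F := fun t y => ‖y‖ ^ (l - d) • u (x - t • y))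
    (F' := fun t y => ‖y‖ ^ (l - d) • -fderiv ℝ u (x - t • y) y)
    (x₀ := (1 : ℝ)) (s := Set.Ioi (1 / 2))
    (bound := fun y => (Metric.closedBall (0 : E) R).indicator
      (fun y => ‖y‖ ^ (l - d)) y * (M * |R|))
    (Ioi_mem_nhds (by norm_num)) ?_ ?_ ?_ ?_ ?_ ?_
  · have h1 : ∀ t : ℝ, 0 < t → ∫ y, ‖y‖ ^ (l - d) • u (x - t • y) =
        t ^ (-l) • ∫ y, ‖y‖ ^ (l - d) • u (x - y) := fun t ht => by
      have h := Measure.integral_comp_smul volume (fun y : E => ‖y‖ ^ (l - d) • u (x - y)) t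
      simp_rw [norm_smul, Real.norm_of_nonneg ht.le, Real.mul_rpow ht.le (norm_nonneg _),
        mul_smul] at h
      rw [integral_smul, abs_of_pos (by positivity), ← Real.rpow_natCast, ← hdd,
        ← Real.rpow_neg ht.le] at h
      have h2 := congrArg (fun w => t ^ (d - l) • w) h
      simp only [smul_smul, ← Real.rpow_add ht] at h2
      rw [show d - l + (l - d) = 0 by ring, show d - l + -d = -l by ring, Real.rpow_zero,
        one_smul] at h2
      exact h2
    have h2 : HasDerivAt (fun t : ℝ => ∫ y, ‖y‖ ^ (l - d) • u (x - t • y))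
        ((-l) • ∫ y, ‖y‖ ^ (l - d) • u (x - y)) 1 := by
      have h3 := (Real.hasDerivAt_rpow_const (x := 1) (p := -l) (Or.inl one_ne_zero)).smul_const
        (∫ y, ‖y‖ ^ (l - d) • u (x - y))
      simp only [Real.one_rpow, mul_one] at h3
      refine h3.congr_of_eventuallyEq ?_
      filter_upwards [Ioi_mem_nhds (zero_lt_one' ℝ)] with t ht
      exact h1 t ht
    have h4 := hderiv.2.unique h2
    simp only [one_smul, smul_neg, neg_smul] at h4
    rw [integral_neg] at h4
    exact neg_injective h4
  · refine Eventually.of_forall fun t => hkm.smul ?_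
    have := hu.continuous
    exact (by fun_prop : Continuous fun y : E => u (x - t • y)).aestronglyMeasurable
  · simpa using integrable_smul_comp_sub hk hu.continuous hc x
  · refine hkm.smul ?_
    exact (by fun_prop : Continuous fun y : E =>
      -fderiv ℝ u (x - (1 : ℝ) • y) y).aestronglyMeasurable
  · refine ae_of_all _ fun y t ht => ?_
    have ht : 1 / 2 < t := ht
    rw [norm_smul, norm_neg, Real.norm_of_nonneg (by positivity)]
    by_cases hy : y ∈ Metric.closedBall (0 : E) R
    · rw [Set.indicator_of_mem hy]
      rw [mem_closedBall_zero_iff] at hy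
      refine mul_le_mul_of_nonneg_left ?_ (by positivity)
      refine (ContinuousLinearMap.le_opNorm _ _).trans ?_
      have := hM (x - t • y)
      exact mul_le_mul this (hy.trans (le_abs_self R)) (norm_nonneg _) ((norm_nonneg _).trans this)
    · rw [Set.indicator_of_notMem hy]
      rw [mem_closedBall_zero_iff, not_le] at hy
      rw [hzero (t • y) ?_]
      · simp
      · rw [norm_smul, Real.norm_of_nonneg (by linarith)]
        nlinarith [norm_nonneg y]
  · refine Integrable.mul_const ?_ _
    exact (hk.integrableOn_isCompact (isCompact_closedBall _ _)).integrable_indicator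
      Metric.isClosed_closedBall.measurableSet
  · refine ae_of_all _ fun y t _ => ?_
    have h1 : HasDerivAt (fun t : ℝ => x - t • y) (-y) t := by
      simpa using ((hasDerivAt_id t).smul_const y).const_sub x
    have h2 := (hu.differentiable one_ne_zero (x - t • y)).hasFDerivAt.comp_hasDerivAt t h1
    rw [map_neg] at h2
    exact h2.const_smul _

end Euler

/-! ### The Riesz potential in terms of the Riesz transforms. -/

section Representation

/-- Averaging over $z$ and $-z$ creates the difference that makes the later use of Fubini absolutely
convergent. -/
theorem integral_odd_smul_comp_sub {E G : Type*} [NormedAddCommGroup E] [MeasurableSpace E]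
    [BorelSpace E] [NormedAddCommGroup G] [NormedSpace ℝ G] {μ : Measure E} [μ.IsNegInvariant]
    {K : E → ℝ} (hK : ∀ z, K (-z) = -K z) {g : E → G} {x : E}
    (hi : Integrable (fun z => K z • g (x - z)) μ) :
    ∫ z, K z • g (x - z) ∂μ = (2⁻¹ : ℝ) • ∫ z, K z • (g (x - z) - g (x + z)) ∂μ := by
  have h1 := hi.comp_neg
  simp only [hK, sub_neg_eq_add, neg_smul] at h1
  have h2 := integral_neg_eq_self (fun z => K z • g (x - z)) μ
  simp only [hK, sub_neg_eq_add, neg_smul] at h2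
  have h3 : ∫ z, K z • (g (x - z) - g (x + z)) ∂μ =
      ∫ z, K z • g (x - z) ∂μ + ∫ z, -(K z • g (x + z)) ∂μ := by
    rw [← integral_add hi h1]
    simp_rw [smul_sub, sub_eq_add_neg]
  rw [h3, h2, ← two_smul ℝ, smul_smul]
  norm_num

theorem locallyIntegrable_comp_sub_right {E G : Type*} [NormedAddCommGroup E] [MeasurableSpace E]
    [BorelSpace E] [NormedAddCommGroup G] [NormedSpace ℝ E] [FiniteDimensional ℝ E]
    {μ : Measure E} [μ.IsAddHaarMeasure]
    {f : E → G} (hf : LocallyIntegrable f μ) (a : E) :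
    LocallyIntegrable (fun y => f (y - a)) μ := by
  rw [locallyIntegrable_iff] at hf ⊢
  intro K hK
  have h := (hf _ (hK.image (continuous_sub_right a))).integrable_indicator
    (hK.image (continuous_sub_right a)).measurableSet
  refine ((h.comp_sub_right a).integrableOn (s := K)).congr_fun (fun y hy => ?_) hK.measurableSet
  exact Set.indicator_of_mem (Set.mem_image_of_mem _ hy) _

variable {𝕜 : Type*} [RCLike 𝕜] {N : ℕ}

/-- The vector kernel `K_j(z) = z_j |z|^{l-N-1}`. -/
noncomputable def vectorKernel (l : ℝ) (j : Fin N) (z : EuclideanSpace ℝ (Fin N)) : ℝ :=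
  z j * ‖z‖ ^ (l - N - 1)

theorem measurable_vectorKernel (l : ℝ) (j : Fin N) : Measurable (vectorKernel l j) := by
  unfold vectorKernel
  fun_prop

theorem abs_vectorKernel_le (l : ℝ) (j : Fin N) (z : EuclideanSpace ℝ (Fin N)) :
    |vectorKernel l j z| ≤ ‖z‖ ^ (l - N) := by
  rcases eq_or_ne z 0 with rfl | hz
  · simp only [vectorKernel, PiLp.zero_apply, zero_mul, abs_zero]
    positivity
  · have h0 : 0 < ‖z‖ := norm_pos_iff.2 hz
    rw [vectorKernel, abs_mul, abs_of_nonneg (by positivity : (0 : ℝ) ≤ ‖z‖ ^ (l - N - 1)),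
      Real.rpow_sub_one h0.ne']
    have h1 : |z j| ≤ ‖z‖ := PiLp.norm_apply_le z j
    calc |z j| * (‖z‖ ^ (l - N) / ‖z‖) ≤ ‖z‖ * (‖z‖ ^ (l - N) / ‖z‖) := by gcongr
      _ = _ := by field_simp

theorem vectorKernel_neg (l : ℝ) (j : Fin N) (z : EuclideanSpace ℝ (Fin N)) :
    vectorKernel l j (-z) = -vectorKernel l j z := by
  simp [vectorKernel]

/-- In the unit ball the kernel is integrable and `g` is bounded; outside it the kernel is at most
`1` and `g` is integrable. -/
theorem integrable_vectorKernel_smul (hN : 1 ≤ N) {l : ℝ} (hl0 : 0 < l) (hlN : l < N)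
    {G : Type*} [NormedAddCommGroup G] [NormedSpace ℝ G]
    {g : EuclideanSpace ℝ (Fin N) → G} (hg : Continuous g) (hgi : Integrable g volume)
    (j : Fin N) (x : EuclideanSpace ℝ (Fin N)) :
    Integrable (fun z => vectorKernel l j z • g (x - z)) volume := by
  have hgx : Continuous fun z => g (x - z) := by fun_prop
  have hms := hgx.aestronglyMeasurable (μ := volume)
  have hm : AEStronglyMeasurable (fun z => vectorKernel l j z • g (x - z)) volume :=
    (measurable_vectorKernel l j).aestronglyMeasurable.smul hms
  have hball : MeasurableSet (Metric.closedBall (0 : EuclideanSpace ℝ (Fin N)) 1) :=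
    Metric.isClosed_closedBall.measurableSet
  rw [← integrableOn_univ, ← Set.union_compl_self (Metric.closedBall 0 1)]
  refine IntegrableOn.union ?_ ?_
  · obtain ⟨M, hM⟩ := (isCompact_closedBall
      (0 : EuclideanSpace ℝ (Fin N)) 1).exists_bound_of_continuousOn hgx.continuousOn
    have hk : IntegrableOn (fun z : EuclideanSpace ℝ (Fin N) => ‖z‖ ^ (l - N))
        (Metric.closedBall 0 1) volume :=
      (locallyIntegrable_norm_rpow (by simpa using hN) (by simp; linarith)).integrableOn_isCompact
        (isCompact_closedBall _ _)
    refine Integrable.mono' (hk.mul_const M) hm.restrict ?_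
    refine (ae_restrict_iff' hball).2 (ae_of_all _ fun z hz => ?_)
    rw [norm_smul]
    exact mul_le_mul (abs_vectorKernel_le l j z) (hM z hz) (norm_nonneg _) (by positivity)
  · refine Integrable.mono' (hgi.comp_sub_left x).norm.integrableOn hm.restrict ?_
    refine (ae_restrict_iff' hball.compl).2 (ae_of_all _ fun z hz => ?_)
    rw [Set.mem_compl_iff, mem_closedBall_zero_iff, not_le] at hz
    rw [norm_smul]
    refine mul_le_of_le_one_left (norm_nonneg _) ((abs_vectorKernel_le l j z).trans ?_)
    exact Real.rpow_le_one_of_one_le_of_nonpos hz.le (by linarith)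

/-- By homogeneity the inner integral over $z$ is at most a constant times $|y|^{l+1-N}$, which is
locally integrable. -/
theorem integrable_prod_oddKernel (hN : 2 ≤ N) {l : ℝ} (hl0 : 0 < l) (hlN : l < N)
    {G : Type*} [NormedAddCommGroup G] [NormedSpace ℝ G]
    {g : EuclideanSpace ℝ (Fin N) → G} (hg : Continuous g) (hgc : HasCompactSupport g)
    (j : Fin N) (x : EuclideanSpace ℝ (Fin N)) :
    Integrable (fun p : EuclideanSpace ℝ (Fin N) × EuclideanSpace ℝ (Fin N) =>
      (oddKernel l p.2 p.1 * p.1 j) • g (x - p.2)) (volume.prod volume) := by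
  have hfin : Module.finrank ℝ (EuclideanSpace ℝ (Fin N)) = N := by simp
  have : Nontrivial (EuclideanSpace ℝ (Fin N)) :=
    Module.nontrivial_of_finrank_pos (R := ℝ) (by omega)
  obtain ⟨e, he⟩ := exists_norm_eq (EuclideanSpace ℝ (Fin N)) zero_le_one
  have hgx : Continuous fun p : EuclideanSpace ℝ (Fin N) × EuclideanSpace ℝ (Fin N) =>
    g (x - p.2) := by fun_prop
  have hm : AEStronglyMeasurable (fun p : EuclideanSpace ℝ (Fin N) × EuclideanSpace ℝ (Fin N) =>
      (oddKernel l p.2 p.1 * p.1 j) • g (x - p.2)) (volume.prod volume) := by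
    refine AEStronglyMeasurable.smul ?_ hgx.aestronglyMeasurable
    exact (((measurable_oddKernel l).comp measurable_swap).mul
      (by fun_prop)).aestronglyMeasurable
  refine ⟨hm, ?_⟩
  have hk : LocallyIntegrable (fun y : EuclideanSpace ℝ (Fin N) => ‖y‖ ^ (l + 1 - N)) volume :=
    locallyIntegrable_norm_rpow (by omega) (by rw [hfin]; linarith)
  have hI := (integrable_smul_comp_sub hk hg hgc x).2
  rw [HasFiniteIntegral] at hI ⊢
  rw [lintegral_prod_symm _ hm.enorm]
  set B := ∫⁻ z : EuclideanSpace ℝ (Fin N), ‖oddKernel l e z • z‖ₑ with hB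
  have hBtop : B < ⊤ := (integrable_oddKernel_smul (by omega) hl0 (by rwa [hfin]) e).2
  have hne : ∀ᵐ y : EuclideanSpace ℝ (Fin N), y ≠ 0 :=
    measure_eq_zero_iff_ae_notMem.1 (measure_singleton 0)
  calc ∫⁻ y, ∫⁻ z, ‖(oddKernel l y z * z j) • g (x - y)‖ₑ
      ≤ ∫⁻ y : EuclideanSpace ℝ (Fin N), B * ‖‖y‖ ^ (l + 1 - N) • g (x - y)‖ₑ := by
        refine lintegral_mono_ae ?_
        filter_upwards [hne] with y hy
        calc ∫⁻ z, ‖(oddKernel l y z * z j) • g (x - y)‖ₑ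
            ≤ ∫⁻ z, ‖oddKernel l y z • z‖ₑ * ‖g (x - y)‖ₑ := by
              refine lintegral_mono fun z => ?_
              rw [enorm_smul, enorm_smul, enorm_mul]
              gcongr
              exact enorm_le_iff_norm_le.2 (PiLp.norm_apply_le z j)
          _ = _ := by
              rw [lintegral_mul_const' _ _ enorm_ne_top, lintegral_oddKernel_smul l he hy, hfin,
                enorm_smul, Real.enorm_of_nonneg (by positivity)]
              ring
    _ = B * ∫⁻ y : EuclideanSpace ℝ (Fin N), ‖‖y‖ ^ (l + 1 - N) • g (x - y)‖ₑ :=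
        lintegral_const_mul' _ _ hBtop.ne
    _ < ⊤ := ENNReal.mul_lt_top hBtop hI

theorem rieszTransform_sub_rieszTransform (hN : 2 ≤ N) {u : EuclideanSpace ℝ (Fin N) → 𝕜}
    (hu : ContDiff ℝ ∞ u) (hc : HasCompactSupport u) (l : ℝ) (j : Fin N)
    (x z : EuclideanSpace ℝ (Fin N)) :
    vectorKernel l j z • (rieszTransform j u (x - z) - rieszTransform j u (x + z)) =
      (transformConst N / (1 - N)) • ∫ y, (oddKernel l y z * z j) •
        fderiv ℝ u (x - y) (EuclideanSpace.single j 1) := by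
  have hu' : Continuous fun y => fderiv ℝ u y (EuclideanSpace.single j 1) := by
    have := hu.continuous_fderiv (by simp)
    fun_prop
  have hk : LocallyIntegrable (fun y : EuclideanSpace ℝ (Fin N) => ‖y‖ ^ (1 - (N : ℝ))) volume :=
    locallyIntegrable_norm_rpow (by simp; omega) (by simp)
  have h1 : ∀ a, rieszTransform j u (x - a) = (transformConst N / (1 - N)) •
      ∫ y, ‖y - a‖ ^ (1 - (N : ℝ)) • fderiv ℝ u (x - y) (EuclideanSpace.single j 1) := fun a => by
    rw [rieszTransform_eq hN j hu hc, ← integral_sub_right_eq_self _ a]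
    simp_rw [sub_sub_sub_cancel_right]
  have hi : ∀ a, Integrable (fun y => ‖y - a‖ ^ (1 - (N : ℝ)) •
      fderiv ℝ u (x - y) (EuclideanSpace.single j 1)) := fun a =>
    integrable_smul_comp_sub (locallyIntegrable_comp_sub_right hk a) hu'
      (hc.fderiv_apply (𝕜 := ℝ) _) x
  have h2 := h1 (-z)
  rw [sub_neg_eq_add] at h2
  rw [h1 z, h2, ← smul_sub, ← integral_sub (hi z) (hi (-z)), smul_comm, ← integral_smul]
  congr 2 with y
  rw [← sub_smul, smul_smul, oddKernel, vectorKernel, sub_neg_eq_add]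
  congr 1
  simp only [finrank_euclideanSpace, Fintype.card_fin]
  ring

theorem transformConst_pos (N : ℕ) : 0 < transformConst N := by
  have := Real.Gamma_pos_of_pos (s := ((N : ℝ) + 1) / 2) (by positivity)
  unfold transformConst
  positivity

/-- After folding and Fubini, the $z$-integral of the odd kernel is $Cy_j|y|^{l-N}$. Summing
$y_j\,\partial_ju(x-y)$ over $j$ gives $Du(x-y)y$, to which Euler's identity applies. The factors of
the constant come from folding, the Riesz kernel, the odd kernel and Euler. -/
theorem sum_integral_vectorKernel_smul_rieszTransform (hN : 2 ≤ N) {l : ℝ} (hl0 : 0 < l)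
    (hlN : l < N) : ∃ C : ℝ, C ≠ 0 ∧ ∀ u : EuclideanSpace ℝ (Fin N) → 𝕜, ContDiff ℝ ∞ u →
      HasCompactSupport u → (∀ j, Integrable (rieszTransform j u) volume) →
      ∀ x, ∑ j, ∫ z, vectorKernel l j z • rieszTransform j u (x - z) =
        C • ∫ y, ‖y‖ ^ (l - N) • u (x - y) := by
  have hfin : Module.finrank ℝ (EuclideanSpace ℝ (Fin N)) = N := by simp
  have hN' : (2 : ℝ) ≤ N := by exact_mod_cast hN
  obtain ⟨C, hC, hH⟩ := exists_integral_oddKernel_smul_eq (E := EuclideanSpace ℝ (Fin N))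
    (l := l) (by omega) hl0 (by rwa [hfin])
  rw [hfin] at hH
  refine ⟨2⁻¹ * (transformConst N / (1 - N)) * C * l, ?_, fun u hu hc hint x => ?_⟩
  · have h1 := (transformConst_pos N).ne'
    have h2 : (1 : ℝ) - N ≠ 0 := by linarith
    positivity
  have hk : LocallyIntegrable (fun y : EuclideanSpace ℝ (Fin N) => ‖y‖ ^ (l - N)) volume :=
    locallyIntegrable_norm_rpow (by omega) (by rw [hfin]; linarith)
  have hu' : Continuous (fderiv ℝ u) := hu.continuous_fderiv (by simp)
  have hterm : ∀ j, ∫ z, vectorKernel l j z • rieszTransform j u (x - z) =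
      (2⁻¹ * (transformConst N / (1 - N)) * C) • ∫ y, ‖y‖ ^ (l - N) •
        fderiv ℝ u (x - y) (y j • EuclideanSpace.single j 1) := fun j => by
    rw [integral_odd_smul_comp_sub (vectorKernel_neg l j) (integrable_vectorKernel_smul
      (by omega) hl0 hlN (continuous_rieszTransform hN hu hc j) (hint j) j x)]
    simp_rw [rieszTransform_sub_rieszTransform hN hu hc]
    rw [integral_smul, integral_integral_swap (integrable_prod_oddKernel hN hl0 hlN
      (g := fun y => fderiv ℝ u y (EuclideanSpace.single j 1)) (by fun_prop)
      (hc.fderiv_apply (𝕜 := ℝ) _) j x), smul_smul, mul_smul _ C, ← integral_smul C]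
    congr 2 with y
    rw [integral_smul_const, map_smul, smul_smul, smul_smul]
    congr 1
    have h1 := congrArg (EuclideanSpace.proj (𝕜 := ℝ) j) (hH y)
    rw [← ContinuousLinearMap.integral_comp_comm _
      (integrable_oddKernel_smul (by omega) hl0 (by rwa [hfin]) y)] at h1
    simpa [mul_assoc] using h1
  have heul := integral_norm_rpow_smul_fderiv_apply_self (E := EuclideanSpace ℝ (Fin N))
    (by omega) hl0 (hu.of_le (by simp)) hc x
  rw [hfin] at heul
  simp_rw [hterm]
  rw [← Finset.smul_sum, mul_smul _ l, ← heul, ← integral_finsetSum]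
  · congr 2 with y
    rw [← Finset.smul_sum, ← map_sum]
    congr 2
    ext i
    simp [Finset.sum_apply, Pi.single_apply]
  · intro j _
    -- The weight $y_j|y|^{l-N}$ is the vector kernel of order $l+1$.
    have hloc : LocallyIntegrable (vectorKernel (l + 1) j) volume :=
      locallyIntegrable_of_norm_le_rpow (C := 1) (α := -(l + 1 - N)) (by omega)
        (by rw [hfin]; linarith) (ae_of_all _ fun y => by
          rw [neg_neg, one_mul]
          exact abs_vectorKernel_le (l + 1) j y) (measurable_vectorKernel _ _).aestronglyMeasurable
    have h1 := integrable_smul_comp_sub hloc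
      (g := fun y => fderiv ℝ u y (EuclideanSpace.single j 1)) (by fun_prop)
      (hc.fderiv_apply (𝕜 := ℝ) _) x
    refine h1.congr (ae_of_all _ fun y => ?_)
    simp only [vectorKernel, map_smul, smul_smul]
    rw [mul_comm, show l + 1 - (N : ℝ) - 1 = l - N by ring]

/-- The Riesz potential is the convolution of the vector Riesz transform with a vector kernel. -/
theorem exists_rieszPotential_eq_sum (hN : 2 ≤ N) {l : ℝ} (hl0 : 0 < l)
    (hlN : l < N) : ∃ C : ℝ, ∀ u : EuclideanSpace ℝ (Fin N) → 𝕜, ContDiff ℝ ∞ u →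
      HasCompactSupport u → (∀ j, Integrable (rieszTransform j u) volume) →
      ∀ x, rieszPotential l u x =
        C • ∑ j, ∫ y, vectorKernel l j (x - y) • rieszTransform j u y := by
  obtain ⟨C, hC, h⟩ := sum_integral_vectorKernel_smul_rieszTransform (𝕜 := 𝕜) hN hl0 hlN
  refine ⟨potentialConst N l / C, fun u hu hc hint x => ?_⟩
  have h1 : ∀ j, ∫ y, vectorKernel l j (x - y) • rieszTransform j u y =
      ∫ z, vectorKernel l j z • rieszTransform j u (x - z) := fun j => by
    rw [← integral_sub_left_eq_self _ volume x]
    simp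
  have h2 : ∫ y, (1 / ‖x - y‖ ^ ((N : ℝ) - l)) • u y = ∫ y, ‖y‖ ^ (l - N) • u (x - y) := by
    rw [← integral_sub_left_eq_self _ volume x]
    simp_rw [sub_sub_cancel, one_div, ← Real.rpow_neg (norm_nonneg _), neg_sub]
  simp_rw [h1]
  rw [h u hu hc hint x, smul_smul, div_mul_cancel₀ _ hC, rieszPotential, h2]

end Representation

/-! ### A Minkowski-type inequality. -/

section Minkowski

variable {X Y : Type*} [MeasurableSpace X] [MeasurableSpace Y]

theorem rpow_lintegral_le_measure_univ_rpow_mul {μ : Measure Y} {q : ℝ} (hq : 1 ≤ q)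
    {f : Y → ENNReal} (hf : Measurable f) :
    (∫⁻ y, f y ∂μ) ^ q ≤ μ Set.univ ^ (q - 1) * ∫⁻ y, f y ^ q ∂μ := by
  rcases hq.eq_or_lt with rfl | hq
  · simp
  have hq0 : 0 < q := by linarith
  have h := ENNReal.lintegral_mul_le_Lp_mul_Lq μ (Real.HolderConjugate.conjExponent hq)
    hf.aemeasurable (aemeasurable_const (b := (1 : ENNReal)))
  simp only [Pi.mul_apply, mul_one, ENNReal.one_rpow, lintegral_const, one_mul] at h
  have h2 := ENNReal.rpow_le_rpow h hq0.le
  rw [ENNReal.mul_rpow_of_nonneg _ _ hq0.le, ← ENNReal.rpow_mul, ← ENNReal.rpow_mul,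
    one_div, inv_mul_cancel₀ hq0.ne', ENNReal.rpow_one, mul_comm] at h2
  have h3 : 1 / Real.conjExponent q * q = q - 1 := by
    rw [Real.conjExponent]
    field_simp
  rwa [h3] at h2

/-- Hölder against the constant `1` moves the power inside the integral over `μ`; Tonelli then
exposes the integral over `ν`, which `B` bounds. -/
theorem lintegral_rpow_lintegral_le {μ : Measure Y} [SFinite μ] {ν : Measure X} [SFinite ν]
    {q : ℝ} (hq : 1 ≤ q) {k : X → Y → ENNReal} (hk : Measurable (Function.uncurry k))
    {B : ENNReal} (hB : ∀ᵐ y ∂μ, ∫⁻ x, k x y ^ q ∂ν ≤ B) :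
    ∫⁻ x, (∫⁻ y, k x y ∂μ) ^ q ∂ν ≤ B * μ Set.univ ^ q := by
  have hq0 : 0 < q := by linarith
  have hkq : Measurable (Function.uncurry fun x y => k x y ^ q) := hk.pow_const q
  calc ∫⁻ x, (∫⁻ y, k x y ∂μ) ^ q ∂ν
      ≤ ∫⁻ x, μ Set.univ ^ (q - 1) * ∫⁻ y, k x y ^ q ∂μ ∂ν :=
        lintegral_mono fun x => rpow_lintegral_le_measure_univ_rpow_mul hq
          (hk.comp measurable_prodMk_left)
    _ = μ Set.univ ^ (q - 1) * ∫⁻ y, ∫⁻ x, k x y ^ q ∂ν ∂μ := by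
        have hm : Measurable fun x => ∫⁻ y, k x y ^ q ∂μ := hkq.lintegral_prod_right'
        rw [lintegral_const_mul _ hm, lintegral_lintegral_swap
          hkq.aemeasurable]
    _ ≤ μ Set.univ ^ (q - 1) * ∫⁻ _, B ∂μ := by
        gcongr 1
        exact lintegral_mono_ae hB
    _ = B * μ Set.univ ^ q := by
        rw [lintegral_const, mul_left_comm]
        congr 1
        conv_lhs => rw [← ENNReal.rpow_one (μ Set.univ), ← ENNReal.rpow_mul, one_mul]
        rw [← ENNReal.rpow_add_of_nonneg _ _ (by linarith) zero_le_one, sub_add_cancel]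

end Minkowski

/-! ### Weighted bounds for the cancelled kernel. -/

section WeightedKernel

variable {E : Type*} [NormedAddCommGroup E]

/-- The size of the kernel of the Riesz potential after subtraction of its value at the origin
in the region `4 |y| < |x|`. -/
noncomputable def cancelledKernel (l d : ℝ) (x y : E) : ℝ :=
  if ‖x‖ ≤ 4 * ‖y‖ then ‖x - y‖ ^ (l - d) else ‖y‖ * ‖x‖ ^ (l - d - 1)

theorem cancelledKernel_nonneg (l d : ℝ) (x y : E) : 0 ≤ cancelledKernel l d x y := by
  unfold cancelledKernel
  split_ifs <;> positivity

variable [InnerProductSpace ℝ E]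

theorem cancelledKernel_map (l d : ℝ) (A : E ≃ₗᵢ[ℝ] E) (x y : E) :
    cancelledKernel l d (A x) (A y) = cancelledKernel l d x y := by
  simp only [cancelledKernel, ← map_sub, LinearIsometryEquiv.norm_map]

theorem cancelledKernel_smul (l d : ℝ) {t : ℝ} (ht : 0 < t) (x y : E) :
    cancelledKernel l d (t • x) (t • y) = t ^ (l - d) * cancelledKernel l d x y := by
  have h : t * ‖x‖ ≤ 4 * (t * ‖y‖) ↔ ‖x‖ ≤ 4 * ‖y‖ := by
    rw [mul_left_comm, mul_le_mul_iff_right₀ ht]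
  simp only [cancelledKernel, ← smul_sub, norm_smul, Real.norm_of_nonneg ht.le, h]
  split_ifs
  · rw [Real.mul_rpow ht.le (norm_nonneg _)]
  · rw [Real.mul_rpow ht.le (norm_nonneg _), Real.rpow_sub_one ht.ne']
    field_simp

variable [FiniteDimensional ℝ E] [MeasurableSpace E] [BorelSpace E]

theorem measurable_cancelledKernel (l d : ℝ) :
    Measurable fun p : E × E => cancelledKernel l d p.1 p.2 := by
  unfold cancelledKernel
  refine Measurable.ite (measurableSet_le ?_ ?_) ?_ ?_ <;> fun_prop

/-- The scaling relation reads $d=q(d+\alpha+\beta-l)$. With it, integrability at $0$ amounts to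
$l<d+\alpha$, at $e$ to $\alpha+\beta>0$, and at infinity, thanks to the extra factor $|x|^{-1}$, to
$\alpha<1$. -/
theorem integrable_weighted_cancelledKernel_rpow (hd : 1 ≤ Module.finrank ℝ E) {l α β q : ℝ}
    (hα1 : α < 1) (hld : l < Module.finrank ℝ E + α) (hαβ : 0 < α + β) (hq1 : 1 ≤ q)
    (hq : 1 / q = 1 + (α + β - l) / Module.finrank ℝ E) {e : E} (he : ‖e‖ = 1) :
    Integrable (fun x => (‖x‖ ^ (-β) * cancelledKernel l (Module.finrank ℝ E) x e) ^ q)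
      volume := by
  have hd' : (1 : ℝ) ≤ Module.finrank ℝ E := by exact_mod_cast hd
  set d : ℝ := ((Module.finrank ℝ E : ℕ) : ℝ) with hdd
  have hq0 : 0 < q := by linarith
  have hdq : d = q * (d + (α + β - l)) := by
    field_simp at hq
    linarith
  have hs : -d < -β * q := by nlinarith
  have ht : -d < (l - d) * q := by nlinarith
  have hr : (l - d - 1 - β) * q < -d := by nlinarith
  have hmeas : Measurable fun x : E => (‖x‖ ^ (-β) * cancelledKernel l d x e) ^ q := by
    have := (measurable_cancelledKernel (E := E) l d).comp
      (measurable_id.prodMk (measurable_const (a := e)))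
    exact ((by fun_prop : Measurable fun x : E => ‖x‖ ^ (-β)).mul this).pow_const q
  have hball : MeasurableSet (Metric.closedBall (0 : E) 4) :=
    Metric.isClosed_closedBall.measurableSet
  rw [← integrableOn_univ, ← Set.union_compl_self (Metric.closedBall (0 : E) 4)]
  refine IntegrableOn.union ?_ ?_
  · refine (integrableOn_norm_rpow_mul_norm_sub_rpow hd hs ht he 4).congr_fun (fun x hx => ?_) hball
    rw [mem_closedBall_zero_iff] at hx
    simp only [cancelledKernel, he, mul_one, if_pos hx]
    rw [Real.mul_rpow (by positivity) (by positivity), ← Real.rpow_mul (norm_nonneg _),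
      ← Real.rpow_mul (norm_nonneg _)]
  · have hsub : (Metric.closedBall (0 : E) 4)ᶜ ⊆ {z | 1 ≤ ‖z‖} := fun z hz => by
      rw [Set.mem_compl_iff, mem_closedBall_zero_iff, not_le] at hz
      exact (le_trans (by norm_num) hz.le : (1 : ℝ) ≤ ‖z‖)
    refine ((integrableOn_norm_rpow_one_le hr).mono_set hsub).congr_fun (fun x hx => ?_) hball.compl
    rw [Set.mem_compl_iff, mem_closedBall_zero_iff, not_le] at hx
    have h0 : 0 < ‖x‖ := by linarith
    simp only [cancelledKernel, he, mul_one, if_neg hx.not_ge, one_mul]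
    rw [← Real.rpow_add h0, ← Real.rpow_mul (norm_nonneg _)]
    congr 1
    ring

/-- The integral is isometry invariant and homogeneous in $y$ of degree $(l-d-\beta)q+d-\alpha q=0$,
so it equals its value at a unit vector. -/
theorem exists_lintegral_weighted_cancelledKernel_rpow_le (hd : 1 ≤ Module.finrank ℝ E)
    {l α β q : ℝ} (hα1 : α < 1) (hld : l < Module.finrank ℝ E + α) (hαβ : 0 < α + β)
    (hq1 : 1 ≤ q) (hq : 1 / q = 1 + (α + β - l) / Module.finrank ℝ E) :
    ∃ B : ENNReal, B ≠ ⊤ ∧ ∀ y : E, y ≠ 0 → ∫⁻ x : E, ENNReal.ofReal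
      (‖x‖ ^ (-β) * cancelledKernel l (Module.finrank ℝ E) x y * ‖y‖ ^ (-α)) ^ q ≤ B := by
  have : Nontrivial E := Module.nontrivial_of_finrank_pos (R := ℝ) hd
  obtain ⟨e, he⟩ := exists_norm_eq E zero_le_one
  have hd' : (1 : ℝ) ≤ Module.finrank ℝ E := by exact_mod_cast hd
  have hint := integrable_weighted_cancelledKernel_rpow hd hα1 hld hαβ hq1 hq he
  set d : ℝ := ((Module.finrank ℝ E : ℕ) : ℝ) with hdd
  have hq0 : 0 < q := by linarith
  have hdq : d = q * (d + (α + β - l)) := by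
    field_simp at hq
    linarith
  set m : E → E → ℝ := fun y x => ‖x‖ ^ (-β) * cancelledKernel l d x y with hm
  have hm0 : ∀ y x, 0 ≤ m y x := fun y x =>
    mul_nonneg (by positivity) (cancelledKernel_nonneg _ _ _ _)
  refine ⟨∫⁻ x, ENNReal.ofReal (m e x) ^ q, ?_, fun y hy => ?_⟩
  · simp_rw [ENNReal.ofReal_rpow_of_nonneg (hm0 _ _) hq0.le]
    exact hint.lintegral_lt_top.ne
  · have h0 : 0 < ‖y‖ := norm_pos_iff.2 hy
    have h := lintegral_eq_of_homogeneous (E := E) (f := fun y x => ENNReal.ofReal (m y x) ^ q)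
      (r := (l - d - β) * q) (fun A w z => ?_) (fun t ht w z => ?_) he hy
    · have h1 : ∀ x, ENNReal.ofReal (m y x * ‖y‖ ^ (-α)) ^ q =
          ENNReal.ofReal (m y x) ^ q * ENNReal.ofReal (‖y‖ ^ (-α * q)) := fun x => by
        rw [ENNReal.ofReal_mul (hm0 _ _), ENNReal.mul_rpow_of_nonneg _ _ hq0.le,
          ENNReal.ofReal_rpow_of_nonneg (x := ‖y‖ ^ (-α)) (by positivity) hq0.le,
          ← Real.rpow_mul h0.le]
      refine le_of_eq ((lintegral_congr h1).trans ?_)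
      rw [lintegral_mul_const' _ _ ENNReal.ofReal_ne_top, h, mul_comm, ← mul_assoc,
        ← ENNReal.ofReal_mul (by positivity), ← Real.rpow_add h0,
        show -α * q + ((l - d - β) * q + d) = 0 by linarith, Real.rpow_zero, ENNReal.ofReal_one,
        one_mul]
    · simp only [hm, cancelledKernel_map, LinearIsometryEquiv.norm_map]
    · have h2 : m (t • w) (t • z) = t ^ (l - d - β) * m w z := by
        simp only [hm]
        rw [cancelledKernel_smul l d ht, norm_smul, Real.norm_of_nonneg ht.le,
          Real.mul_rpow ht.le (norm_nonneg _), show l - d - β = -β + (l - d) by ring,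
          Real.rpow_add ht]
        ring
      rw [h2, ENNReal.ofReal_mul (by positivity), ENNReal.mul_rpow_of_nonneg _ _ hq0.le,
        ENNReal.ofReal_rpow_of_nonneg (by positivity) hq0.le, ← Real.rpow_mul ht.le]

end WeightedKernel

/-! ### Cancellation from the curl-free condition. -/

section Cancellation

variable {𝕜 : Type*} [RCLike 𝕜] {N : ℕ}

/-- A smooth cutoff function, equal to `1` for `|y| ≤ 1/4` and to `0` for `|y| ≥ 1/2`. -/
noncomputable def cutoff (N : ℕ) : ContDiffBump (0 : EuclideanSpace ℝ (Fin N)) where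
  rIn := 1 / 4
  rOut := 1 / 2
  rIn_pos := by norm_num
  rIn_lt_rOut := by norm_num

theorem fderiv_cutoff_eq_zero {z : EuclideanSpace ℝ (Fin N)} (hz : ‖z‖ < 1 / 4 ∨ 1 / 2 < ‖z‖) :
    fderiv ℝ (cutoff N) z = 0 := by
  rcases hz with hz | hz
  · rw [((cutoff N).eventuallyEq_one_of_mem_ball (by simpa [cutoff] using hz)).fderiv_eq]
    exact fderiv_const_apply 1
  · refine image_eq_zero_of_notMem_tsupport fun h => ?_
    have := tsupport_fderiv_subset ℝ h
    rw [(cutoff N).tsupport_eq, mem_closedBall_zero_iff] at this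
    exact hz.not_ge this

theorem cutoff_smul_eq_one {r : ℝ} (hr : 0 < r) {y : EuclideanSpace ℝ (Fin N)}
    (hy : 4 * ‖y‖ ≤ r) : cutoff N (r⁻¹ • y) = 1 := by
  refine (cutoff N).one_of_mem_closedBall ?_
  rw [mem_closedBall_zero_iff, norm_smul, norm_inv, Real.norm_of_nonneg hr.le,
    inv_mul_le_iff₀ hr]
  simp only [cutoff]
  linarith

theorem cutoff_smul_eq_zero {r : ℝ} (hr : 0 < r) {y : EuclideanSpace ℝ (Fin N)}
    (hy : r ≤ 2 * ‖y‖) : cutoff N (r⁻¹ • y) = 0 := by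
  refine (cutoff N).zero_of_le_dist ?_
  rw [dist_zero_right, norm_smul, norm_inv, Real.norm_of_nonneg hr.le, le_inv_mul_iff₀ hr]
  simp only [cutoff]
  linarith

theorem enorm_rieszTransform_le (u : EuclideanSpace ℝ (Fin N) → 𝕜) (j : Fin N)
    (y : EuclideanSpace ℝ (Fin N)) : ‖rieszTransform j u y‖ₑ ≤ ‖vectorRiesz u y‖ₑ :=
  enorm_le_iff_norm_le.2 (PiLp.norm_apply_le (vectorRiesz u y) j)

theorem continuous_cutoff_smul (r : ℝ) :
    Continuous fun y : EuclideanSpace ℝ (Fin N) => cutoff N (r⁻¹ • y) :=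
  (cutoff N).continuous.comp (continuous_const_smul _)

theorem hasCompactSupport_cutoff_smul {r : ℝ} (hr : 0 < r) :
    HasCompactSupport fun y : EuclideanSpace ℝ (Fin N) => cutoff N (r⁻¹ • y) :=
  (cutoff N).hasCompactSupport.comp_homeomorph (Homeomorph.smulOfNeZero r⁻¹ (inv_ne_zero hr.ne'))

theorem measurableSet_annulus (r : ℝ) :
    MeasurableSet {y : EuclideanSpace ℝ (Fin N) | r ≤ 4 * ‖y‖ ∧ 2 * ‖y‖ ≤ r} := by
  have h1 : MeasurableSet {y : EuclideanSpace ℝ (Fin N) | r ≤ 4 * ‖y‖} :=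
    measurableSet_le measurable_const (by fun_prop)
  have h2 : MeasurableSet {y : EuclideanSpace ℝ (Fin N) | 2 * ‖y‖ ≤ r} :=
    measurableSet_le (by fun_prop) measurable_const
  exact h1.inter h2

/-- The local means of the vector Riesz transform are controlled by its size on an annulus. -/
theorem exists_enorm_integral_cutoff_smul_rieszTransform_le (hN : 2 ≤ N) :
    ∃ M : ℝ, 0 ≤ M ∧ ∀ u : EuclideanSpace ℝ (Fin N) → 𝕜, ContDiff ℝ ∞ u → HasCompactSupport u →
      ∀ (j : Fin N) (r : ℝ), 0 < r →
        ‖∫ y, cutoff N (r⁻¹ • y) • rieszTransform j u y‖ₑ ≤ ENNReal.ofReal M *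
          ∫⁻ y in {y | r ≤ 4 * ‖y‖ ∧ 2 * ‖y‖ ≤ r}, ‖vectorRiesz u y‖ₑ := by
  have hφ1 : Continuous (fderiv ℝ (cutoff N)) := (cutoff N).contDiff.continuous_fderiv one_ne_zero
  obtain ⟨M, hM⟩ := ((cutoff N).hasCompactSupport.fderiv ℝ).exists_bound_of_continuous hφ1
  have hM0 : 0 ≤ M := (norm_nonneg _).trans (hM 0)
  refine ⟨2 * M, by positivity, fun u hu hc j r hr => ?_⟩
  have : Nontrivial (Fin N) := Fin.nontrivial_iff_two_le.2 hN
  -- With $\psi=y_k\varphi(y/r)$ and $k\ne j$, the derivative $\partial_j\psi$ falls only on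
  -- $\varphi$, while $\partial_k\psi$ also produces $\varphi(y/r)$. The curl identity thus writes
  -- the mean of $R_ju$ as two integrals against $a_i=y_k\,\partial_i[\varphi(y/r)]$, whence the
  -- factor $2$.
  obtain ⟨k, hkj⟩ := exists_ne j
  set S : Set (EuclideanSpace ℝ (Fin N)) := {y | r ≤ 4 * ‖y‖ ∧ 2 * ‖y‖ ≤ r} with hS
  have hSm : MeasurableSet S := measurableSet_annulus r
  set a : Fin N → EuclideanSpace ℝ (Fin N) → ℝ := fun i y =>
    y k * fderiv ℝ (cutoff N) (r⁻¹ • y) (r⁻¹ • EuclideanSpace.single i 1) with ha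
  have hacont : ∀ i, Continuous (a i) := fun i => by
    simp only [ha]
    fun_prop
  -- The bound does not depend on `r`: the gradient of the rescaled cutoff costs `r⁻¹`, and `|y k| ≤
  -- r` on the annulus compensates.
  have habs : ∀ i y, ‖a i y‖ₑ ≤ S.indicator (fun _ => ENNReal.ofReal M) y := by
    intro i y
    by_cases hy : y ∈ S
    · rw [Set.indicator_of_mem hy, ← ofReal_norm]
      refine ENNReal.ofReal_le_ofReal ?_
      have h1 : |y k| ≤ r := by
        have h2 : |y k| ≤ ‖y‖ := PiLp.norm_apply_le y k
        have := hy.2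
        linarith [norm_nonneg y]
      have h3 : ‖fderiv ℝ (cutoff N) (r⁻¹ • y) (r⁻¹ • EuclideanSpace.single i 1)‖ ≤ M * r⁻¹ := by
        refine (ContinuousLinearMap.le_opNorm _ _).trans ?_
        rw [norm_smul, norm_inv, Real.norm_of_nonneg hr.le, PiLp.norm_single, norm_one,
          mul_one]
        exact mul_le_mul_of_nonneg_right (hM _) (by positivity)
      rw [norm_mul]
      calc ‖y k‖ * _ ≤ r * (M * r⁻¹) := mul_le_mul h1 h3 (norm_nonneg _) hr.le
        _ = M := by field_simp
    · have h1 : fderiv ℝ (cutoff N) (r⁻¹ • y) = 0 := by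
        refine fderiv_cutoff_eq_zero ?_
        rw [norm_smul, norm_inv, Real.norm_of_nonneg hr.le, inv_mul_lt_iff₀ hr,
          lt_inv_mul_iff₀ hr]
        by_contra! h
        exact hy ⟨by linarith, by linarith⟩
      simp [ha, h1]
  have hasupp : ∀ i, HasCompactSupport (a i) := fun i => by
    refine HasCompactSupport.intro (isCompact_closedBall 0 r) fun y hy => ?_
    rw [mem_closedBall_zero_iff, not_le] at hy
    have h := habs i y
    rw [Set.indicator_of_notMem (fun h => by have := h.2; linarith [norm_nonneg y])] at h
    simpa using h
  have hFc := continuous_rieszTransform hN hu hc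
  have hai : ∀ i i', Integrable (fun y => a i y • rieszTransform i' u y) volume := fun i i' =>
    Continuous.integrable_of_hasCompactSupport ((hacont i).smul (hFc i')) (hasupp i).smul_right
  have hφi : Integrable (fun y => cutoff N (r⁻¹ • y) • rieszTransform j u y) volume :=
    Continuous.integrable_of_hasCompactSupport ((continuous_cutoff_smul r).smul (hFc j))
      (hasCompactSupport_cutoff_smul hr).smul_right
  have hψd : ∀ y v : EuclideanSpace ℝ (Fin N),
      fderiv ℝ (fun y : EuclideanSpace ℝ (Fin N) => y k * cutoff N (r⁻¹ • y)) y v =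
      y k * fderiv ℝ (cutoff N) (r⁻¹ • y) (r⁻¹ • v) + cutoff N (r⁻¹ • y) * v k := fun y v => by
    have h1 : HasFDerivAt (fun y : EuclideanSpace ℝ (Fin N) => y k)
        (EuclideanSpace.proj (𝕜 := ℝ) k) y := (EuclideanSpace.proj (𝕜 := ℝ) k).hasFDerivAt
    have h2 : HasFDerivAt (fun y : EuclideanSpace ℝ (Fin N) => r⁻¹ • y)
        (r⁻¹ • ContinuousLinearMap.id ℝ _) y := (hasFDerivAt_id y).const_smul r⁻¹
    have h3 : HasFDerivAt (cutoff N) (fderiv ℝ (cutoff N) (r⁻¹ • y)) (r⁻¹ • y) :=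
      ((cutoff N).contDiff.differentiable one_ne_zero _).hasFDerivAt
    have h4 : HasFDerivAt (fun y : EuclideanSpace ℝ (Fin N) => y k * cutoff N (r⁻¹ • y)) _ y :=
      h1.mul (h3.comp y h2)
    rw [h4.fderiv]
    simp
  have hψs : ContDiff ℝ ∞ fun y : EuclideanSpace ℝ (Fin N) => y k * cutoff N (r⁻¹ • y) := by
    have h1 : ContDiff ℝ ∞ fun y : EuclideanSpace ℝ (Fin N) => y k :=
      (EuclideanSpace.proj (𝕜 := ℝ) k).contDiff
    exact h1.mul ((cutoff N).contDiff.comp (contDiff_const_smul _))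
  have hcurl := integral_fderiv_smul_rieszTransform_comm hN hu hc hψs
    (hasCompactSupport_cutoff_smul hr).mul_left j k
  have hL : ∀ y, fderiv ℝ (fun y : EuclideanSpace ℝ (Fin N) => y k * cutoff N (r⁻¹ • y)) y
      (EuclideanSpace.single j 1) = a j y := fun y => by
    rw [hψd]
    simp [ha, hkj]
  have hR : ∀ y, fderiv ℝ (fun y : EuclideanSpace ℝ (Fin N) => y k * cutoff N (r⁻¹ • y)) y
      (EuclideanSpace.single k 1) = a k y + cutoff N (r⁻¹ • y) := fun y => by
    rw [hψd]
    simp [ha]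
  simp_rw [hL, hR, add_smul] at hcurl
  rw [integral_add (hai k j) hφi] at hcurl
  have hle : ∀ i i', ‖∫ y, a i y • rieszTransform i' u y‖ₑ ≤
      ENNReal.ofReal M * ∫⁻ y in S, ‖vectorRiesz u y‖ₑ := fun i i' => by
    refine (enorm_integral_le_lintegral_enorm _).trans ?_
    rw [← lintegral_const_mul' _ _ ENNReal.ofReal_ne_top, ← lintegral_indicator hSm]
    refine lintegral_mono fun y => ?_
    rw [enorm_smul]
    refine (mul_le_mul' (habs i y) (enorm_rieszTransform_le u i' y)).trans ?_
    by_cases hy : y ∈ S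
    · rw [Set.indicator_of_mem hy, Set.indicator_of_mem hy]
    · rw [Set.indicator_of_notMem hy, Set.indicator_of_notMem hy, zero_mul]
  rw [← sub_eq_iff_eq_add'.2 hcurl]
  refine enorm_sub_le.trans ((add_le_add (hle j k) (hle k j)).trans_eq ?_)
  rw [ENNReal.ofReal_mul zero_le_two, ← two_mul, ENNReal.ofReal_ofNat, mul_assoc]

theorem norm_rpow_le_of_two_mul_le {s : ℝ} (hs : s ≤ 0) {x y : EuclideanSpace ℝ (Fin N)}
    (hx : x ≠ 0) (hxy : 2 * ‖y‖ ≤ ‖x‖) : ‖x‖ ^ s ≤ 2 ^ (-s) * ‖x - y‖ ^ s := by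
  have h0 : 0 < ‖x‖ := norm_pos_iff.2 hx
  have h1 : 0 < ‖x - y‖ := by
    have := norm_sub_norm_le x y
    linarith
  have h2 : ‖x - y‖ ≤ 2 * ‖x‖ := by
    have := norm_sub_le x y
    linarith
  have h3 := Real.rpow_le_rpow_of_nonpos h1 h2 hs
  rw [Real.mul_rpow zero_le_two h0.le] at h3
  rw [Real.rpow_neg zero_le_two, ← div_eq_inv_mul, le_div_iff₀' (by positivity)]
  exact h3

/-- The difference is split into the increment of the power, estimated by the mean value inequality
at distance at least $|x|/2$ from the origin, and the increment of the linear factor. -/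
theorem abs_vectorKernel_sub_sub_le {l : ℝ} (hlN : l < N) (j : Fin N)
    {x y : EuclideanSpace ℝ (Fin N)} (hx : x ≠ 0) (hxy : 4 * ‖y‖ ≤ ‖x‖) :
    |vectorKernel l j (x - y) - vectorKernel l j x| ≤
      (2 * |l - N - 1| * 2 ^ (1 - (l - N - 1)) + 1) * (‖y‖ * ‖x‖ ^ (l - N - 1)) := by
  have h0 : 0 < ‖x‖ := norm_pos_iff.2 hx
  set s : ℝ := l - N - 1 with hs
  have h1 : ‖x‖ / 2 ≤ ‖x - y‖ := by
    have := norm_sub_norm_le x y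
    linarith [norm_nonneg y]
  have h2 : ‖x - y‖ ≤ 2 * ‖x‖ := by
    have := norm_sub_le x y
    linarith [norm_nonneg y]
  have h3 := abs_rpow_sub_rpow_le (s := s) (by linarith) (half_pos h0) h1 (half_le_self h0.le)
  have h4 : |‖x - y‖ - ‖x‖| ≤ ‖y‖ := by
    have := abs_norm_sub_norm_le (x - y) x
    rwa [sub_sub_cancel_left, norm_neg] at this
  have h5 : |(x - y) j| ≤ 2 * ‖x‖ := (PiLp.norm_apply_le (x - y) j).trans h2
  have h6 : |y j| ≤ ‖y‖ := PiLp.norm_apply_le y j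
  have h7 : (‖x‖ / 2) ^ (s - 1) = 2 ^ (1 - s) * (‖x‖ ^ s / ‖x‖) := by
    rw [Real.div_rpow h0.le zero_le_two, ← Real.rpow_sub_one h0.ne', show 1 - s = -(s - 1) by ring,
      Real.rpow_neg zero_le_two]
    field_simp
  have h8 : vectorKernel l j (x - y) - vectorKernel l j x =
      (x - y) j * (‖x - y‖ ^ s - ‖x‖ ^ s) - y j * ‖x‖ ^ s := by
    simp only [vectorKernel, ← hs, PiLp.sub_apply]
    ring
  rw [h8]
  refine (abs_sub _ _).trans ?_
  rw [abs_mul, abs_mul, abs_of_nonneg (by positivity : 0 ≤ ‖x‖ ^ s)]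
  calc |(x - y) j| * |‖x - y‖ ^ s - ‖x‖ ^ s| + |y j| * ‖x‖ ^ s
      ≤ (2 * ‖x‖) * (|s| * (‖x‖ / 2) ^ (s - 1) * ‖y‖) + ‖y‖ * ‖x‖ ^ s := by
        gcongr
        exact h3.trans (by gcongr)
    _ = _ := by
        rw [h7]
        field_simp

/-- For $4|y|<|x|$ the cutoff is $1$ and the difference gains a factor $|y|/|x|$. Otherwise the two
terms are bounded separately: the cutoff vanishes unless $2|y|\le|x|$, and then $|x-y|\le2|x|$. -/
theorem exists_abs_vectorKernel_sub_cutoff_le {l : ℝ} (hlN : l < N) :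
    ∃ C : ℝ, 0 ≤ C ∧ ∀ (j : Fin N) (x y : EuclideanSpace ℝ (Fin N)), x ≠ 0 →
      |vectorKernel l j (x - y) - cutoff N (‖x‖⁻¹ • y) * vectorKernel l j x| ≤
        C * cancelledKernel l N x y := by
  set A : ℝ := 2 * |l - N - 1| * 2 ^ (1 - (l - N - 1)) + 1 with hA
  set B : ℝ := 2 ^ (-(l - N)) with hB
  have hA0 : 0 ≤ A := by positivity
  have hB0 : 0 ≤ B := by positivity
  refine ⟨A + (1 + B), by positivity, fun j x y hx => ?_⟩
  have h0 : 0 < ‖x‖ := norm_pos_iff.2 hx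
  rw [cancelledKernel]
  split_ifs with h
  · have hp : 0 ≤ ‖x - y‖ ^ (l - N) := by positivity
    have h1 : |cutoff N (‖x‖⁻¹ • y) * vectorKernel l j x| ≤ B * ‖x - y‖ ^ (l - N) := by
      rcases le_total ‖x‖ (2 * ‖y‖) with h' | h'
      · rw [cutoff_smul_eq_zero h0 h', zero_mul, abs_zero]
        positivity
      · rw [abs_mul, abs_of_nonneg (cutoff N).nonneg]
        refine (mul_le_of_le_one_left (abs_nonneg _) (cutoff N).le_one).trans ?_
        exact (abs_vectorKernel_le l j x).trans (norm_rpow_le_of_two_mul_le (by linarith) hx h')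
    refine (abs_sub _ _).trans ((add_le_add (abs_vectorKernel_le l j _) h1).trans ?_)
    nlinarith [mul_nonneg hA0 hp]
  · have hp : 0 ≤ ‖y‖ * ‖x‖ ^ (l - N - 1) := by positivity
    rw [cutoff_smul_eq_one h0 (by linarith), one_mul]
    refine (abs_vectorKernel_sub_sub_le hlN j hx (by linarith)).trans ?_
    nlinarith [mul_nonneg hB0 hp]

/-- The kernel is split as its cancelled part plus $\varphi(y/|x|)K_j(x)$. The second part is
bounded by $|K_j(x)|$ times the integral of $|Ru|$ over an annulus, where $|x|^{l-N}$ is at most a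
multiple of `cancelledKernel`. -/
theorem exists_enorm_integral_vectorKernel_smul_rieszTransform_le (hN : 2 ≤ N) {l : ℝ}
    (hl0 : 0 < l) (hlN : l < N) :
    ∃ C : ℝ, 0 ≤ C ∧ ∀ u : EuclideanSpace ℝ (Fin N) → 𝕜, ContDiff ℝ ∞ u → HasCompactSupport u →
      (∀ j, Integrable (rieszTransform j u) volume) →
      ∀ (j : Fin N) (x : EuclideanSpace ℝ (Fin N)), x ≠ 0 →
        ‖∫ y, vectorKernel l j (x - y) • rieszTransform j u y‖ₑ ≤ ENNReal.ofReal C *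
          ∫⁻ y, ENNReal.ofReal (cancelledKernel l N x y) * ‖vectorRiesz u y‖ₑ := by
  obtain ⟨M, hM0, hM⟩ := exists_enorm_integral_cutoff_smul_rieszTransform_le (𝕜 := 𝕜) hN
  obtain ⟨A, hA0, hA⟩ := exists_abs_vectorKernel_sub_cutoff_le (N := N) hlN
  set B : ℝ := 2 ^ (-(l - N)) with hB
  have hB0 : 0 ≤ B := by positivity
  refine ⟨A + M * B, by positivity, fun u hu hc hint j x hx => ?_⟩
  have h0 : 0 < ‖x‖ := norm_pos_iff.2 hx
  set I := ∫⁻ y, ENNReal.ofReal (cancelledKernel l N x y) * ‖vectorRiesz u y‖ₑ with hI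
  have hFc := continuous_rieszTransform hN hu hc j
  have hi1 : Integrable (fun y => vectorKernel l j (x - y) • rieszTransform j u y) volume := by
    have := (integrable_vectorKernel_smul (by omega) hl0 hlN hFc (hint j) j x).comp_sub_left x
    simpa using this
  have hi2 : Integrable (fun y => cutoff N (‖x‖⁻¹ • y) • rieszTransform j u y) volume :=
    Continuous.integrable_of_hasCompactSupport ((continuous_cutoff_smul _).smul hFc)
      (hasCompactSupport_cutoff_smul h0).smul_right
  have hsplit : ∫ y, vectorKernel l j (x - y) • rieszTransform j u y =
      (∫ y, (vectorKernel l j (x - y) - cutoff N (‖x‖⁻¹ • y) * vectorKernel l j x) •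
        rieszTransform j u y) +
      vectorKernel l j x • ∫ y, cutoff N (‖x‖⁻¹ • y) • rieszTransform j u y := by
    rw [← integral_smul, ← integral_add]
    · congr 1 with y
      rw [smul_smul, ← add_smul]
      congr 1
      ring
    · refine (hi1.sub (hi2.smul (vectorKernel l j x))).congr (ae_of_all _ fun y => ?_)
      simp only [Pi.sub_apply, Pi.smul_apply, smul_smul, sub_smul]
      rw [mul_comm]
    · exact hi2.smul _
  have h1 : ‖∫ y, (vectorKernel l j (x - y) - cutoff N (‖x‖⁻¹ • y) * vectorKernel l j x) •
      rieszTransform j u y‖ₑ ≤ ENNReal.ofReal A * I := by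
    refine (enorm_integral_le_lintegral_enorm _).trans ?_
    rw [← lintegral_const_mul' _ _ ENNReal.ofReal_ne_top]
    refine lintegral_mono fun y => ?_
    rw [enorm_smul, ← mul_assoc, ← ENNReal.ofReal_mul hA0, ← ofReal_norm]
    exact mul_le_mul' (ENNReal.ofReal_le_ofReal (hA j x y hx)) (enorm_rieszTransform_le u j y)
  have h2 : ‖vectorKernel l j x • ∫ y, cutoff N (‖x‖⁻¹ • y) • rieszTransform j u y‖ₑ ≤
      ENNReal.ofReal (M * B) * I := by
    rw [enorm_smul]
    refine (mul_le_mul' (le_of_eq (ofReal_norm _).symm) (hM u hu hc j _ h0)).trans ?_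
    rw [mul_left_comm, ENNReal.ofReal_mul hM0, mul_assoc]
    gcongr 1
    rw [← lintegral_const_mul' _ _ ENNReal.ofReal_ne_top,
      ← lintegral_const_mul' _ _ ENNReal.ofReal_ne_top]
    have hSm : MeasurableSet {y : EuclideanSpace ℝ (Fin N) | ‖x‖ ≤ 4 * ‖y‖ ∧ 2 * ‖y‖ ≤ ‖x‖} :=
      measurableSet_annulus ‖x‖
    refine (setLIntegral_mono' hSm fun y hy => ?_).trans (setLIntegral_le_lintegral _ _)
    rw [← mul_assoc, ← ENNReal.ofReal_mul hB0, cancelledKernel, if_pos hy.1]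
    gcongr 1
    refine ENNReal.ofReal_le_ofReal ((abs_vectorKernel_le l j x).trans ?_)
    exact norm_rpow_le_of_two_mul_le (by linarith) hx hy.2
  rw [hsplit, ENNReal.ofReal_add hA0 (by positivity), add_mul]
  exact (enorm_add_le _ _).trans (add_le_add h1 h2)

end Cancellation

/-! ### The weighted inequality. -/

section SteinWeissInequality

variable {𝕜 : Type*} [RCLike 𝕜] {N : ℕ}

theorem continuous_vectorRiesz (hN : 2 ≤ N) {u : EuclideanSpace ℝ (Fin N) → 𝕜}
    (hu : ContDiff ℝ ∞ u) (hc : HasCompactSupport u) : Continuous (vectorRiesz u) :=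
  (PiLp.continuous_toLp 2 _).comp (continuous_pi fun j => continuous_rieszTransform hN hu hc j)

/-- Continuity gives integrability on the unit ball; outside it the weight is at least `1` because
`0 ≤ α`. -/
theorem integrable_rieszTransform (hN : 2 ≤ N) {u : EuclideanSpace ℝ (Fin N) → 𝕜}
    (hu : ContDiff ℝ ∞ u) (hc : HasCompactSupport u) {α : ℝ} (hα : 0 ≤ α)
    (hL : MemLp (fun x => (‖x‖ ^ α) • vectorRiesz u x) 1 volume) (j : Fin N) :
    Integrable (rieszTransform j u) volume := by
  have hcont := continuous_rieszTransform hN hu hc j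
  have hball : MeasurableSet (Metric.closedBall (0 : EuclideanSpace ℝ (Fin N)) 1) :=
    Metric.isClosed_closedBall.measurableSet
  rw [← integrableOn_univ, ← Set.union_compl_self (Metric.closedBall 0 1)]
  refine (hcont.continuousOn.integrableOn_compact (isCompact_closedBall _ _)).union ?_
  refine Integrable.mono (memLp_one_iff_integrable.1 hL).integrableOn
    hcont.aestronglyMeasurable ?_
  refine (ae_restrict_iff' hball.compl).2 (ae_of_all _ fun x hx => ?_)
  rw [Set.mem_compl_iff, mem_closedBall_zero_iff, not_le] at hx
  rw [norm_smul, Real.norm_of_nonneg (by positivity)]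
  exact (PiLp.norm_apply_le (vectorRiesz u x) j).trans
    (le_mul_of_one_le_left (norm_nonneg _) (Real.one_le_rpow hx.le hα))

theorem exists_enorm_rieszPotential_le (hN : 2 ≤ N) {l : ℝ} (hl0 : 0 < l) (hlN : l < N) :
    ∃ C : ℝ, 0 ≤ C ∧ ∀ u : EuclideanSpace ℝ (Fin N) → 𝕜, ContDiff ℝ ∞ u → HasCompactSupport u →
      (∀ j, Integrable (rieszTransform j u) volume) →
      ∀ x : EuclideanSpace ℝ (Fin N), x ≠ 0 → ‖rieszPotential l u x‖ₑ ≤ ENNReal.ofReal C *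
        ∫⁻ y, ENNReal.ofReal (cancelledKernel l N x y) * ‖vectorRiesz u y‖ₑ := by
  obtain ⟨A, hA⟩ := exists_rieszPotential_eq_sum (𝕜 := 𝕜) hN hl0 hlN
  obtain ⟨C, hC0, hC⟩ :=
    exists_enorm_integral_vectorKernel_smul_rieszTransform_le (𝕜 := 𝕜) hN hl0 hlN
  refine ⟨|A| * (N * C), by positivity, fun u hu hc hint x hx => ?_⟩
  rw [hA u hu hc hint x, enorm_smul, ENNReal.ofReal_mul (abs_nonneg A), mul_assoc,
    ← Real.norm_eq_abs, ofReal_norm]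
  gcongr 1
  refine (enorm_sum_le _ _).trans
    ((Finset.sum_le_sum fun j _ => hC u hu hc hint j x hx).trans_eq ?_)
  rw [Finset.sum_const, Finset.card_univ, Fintype.card_fin, nsmul_eq_mul,
    ENNReal.ofReal_mul (by positivity), ENNReal.ofReal_natCast, mul_assoc]

/-- The weighted `L^1` to `L^q` bound for the positive operator with the cancelled kernel. -/
theorem exists_lintegral_rpow_lintegral_cancelledKernel_le (hN : 1 ≤ N) {l α β q : ℝ}
    (hα0 : 0 ≤ α) (hα1 : α < 1) (hlN : l < N) (hαβ : 0 < α + β) (hq1 : 1 ≤ q)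
    (hq : 1 / q = 1 + (α + β - l) / N) :
    ∃ B : ENNReal, B ≠ ⊤ ∧ ∀ F : EuclideanSpace ℝ (Fin N) → ENNReal, Measurable F →
      ∫⁻ x : EuclideanSpace ℝ (Fin N), (ENNReal.ofReal (‖x‖ ^ (-β)) *
        ∫⁻ y, ENNReal.ofReal (cancelledKernel l N x y) * F y) ^ q ≤
      B * (∫⁻ y, ENNReal.ofReal (‖y‖ ^ α) * F y) ^ q := by
  have hfin : Module.finrank ℝ (EuclideanSpace ℝ (Fin N)) = N := by simp
  obtain ⟨B, hB, hBy⟩ := exists_lintegral_weighted_cancelledKernel_rpow_le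
    (E := EuclideanSpace ℝ (Fin N)) (l := l) (α := α) (β := β) (q := q) (by omega) hα1
    (by rw [hfin]; linarith) hαβ hq1 (by rw [hfin]; exact hq)
  rw [hfin] at hBy
  refine ⟨B, hB, fun F hF => ?_⟩
  have : Nontrivial (EuclideanSpace ℝ (Fin N)) :=
    Module.nontrivial_of_finrank_pos (R := ℝ) (by omega)
  have hne : ∀ᵐ y : EuclideanSpace ℝ (Fin N), y ≠ 0 :=
    measure_eq_zero_iff_ae_notMem.1 (measure_singleton 0)
  -- Taken as a density, the weighted function makes the right-hand side the total mass of a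
  -- measure; the kernel is divided by $|y|^\alpha$ in exchange.
  set w : EuclideanSpace ℝ (Fin N) → ENNReal := fun y => ENNReal.ofReal (‖y‖ ^ α) * F y with hw
  have hwm : Measurable w := by
    simp only [hw]
    fun_prop
  set k : EuclideanSpace ℝ (Fin N) → EuclideanSpace ℝ (Fin N) → ENNReal := fun x y =>
    ENNReal.ofReal (‖x‖ ^ (-β) * cancelledKernel l N x y * ‖y‖ ^ (-α)) with hk
  have hkm : Measurable (Function.uncurry k) :=
    (((by fun_prop : Measurable fun p : EuclideanSpace ℝ (Fin N) × EuclideanSpace ℝ (Fin N) =>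
      ‖p.1‖ ^ (-β)).mul (measurable_cancelledKernel l N)).mul (by fun_prop)).ennreal_ofReal
  have hkw : ∀ x, ∫⁻ y, k x y ∂(volume.withDensity w) = ENNReal.ofReal (‖x‖ ^ (-β)) *
      ∫⁻ y, ENNReal.ofReal (cancelledKernel l N x y) * F y := fun x => by
    have hkx : Measurable (k x) := hkm.of_uncurry_left
    rw [lintegral_withDensity_eq_lintegral_mul _ hwm hkx,
      ← lintegral_const_mul' _ _ ENNReal.ofReal_ne_top]
    refine lintegral_congr_ae ?_
    filter_upwards [hne] with y hy
    have h0 : 0 < ‖y‖ := norm_pos_iff.2 hy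
    have hc := cancelledKernel_nonneg l N x y
    have h1 : ENNReal.ofReal (‖y‖ ^ α) * ENNReal.ofReal (‖y‖ ^ (-α)) = 1 := by
      rw [← ENNReal.ofReal_mul (by positivity), ← Real.rpow_add h0, add_neg_cancel,
        Real.rpow_zero, ENNReal.ofReal_one]
    simp only [Pi.mul_apply, hw, hk]
    rw [ENNReal.ofReal_mul (by positivity), ENNReal.ofReal_mul (by positivity)]
    calc _ = (ENNReal.ofReal (‖y‖ ^ α) * ENNReal.ofReal (‖y‖ ^ (-α))) *
          (ENNReal.ofReal (‖x‖ ^ (-β)) * (ENNReal.ofReal (cancelledKernel l N x y) * F y)) := by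
            ring
      _ = _ := by rw [h1, one_mul]
  have hmain := lintegral_rpow_lintegral_le (μ := volume.withDensity w) (ν := volume) hq1 hkm
    (B := B) ((withDensity_absolutelyContinuous volume w).ae_le (hne.mono hBy))
  simp_rw [hkw] at hmain
  rwa [withDensity_apply _ MeasurableSet.univ, setLIntegral_univ] at hmain

end SteinWeissInequality

end SteinWeiss

theorem mainTheorem5 {𝕜 : Type*} [RCLike 𝕜] (N : ℕ) (hN : 2 ≤ N) (l α β q : ℝ)
    (hl0 : 0 < l) (hlN : l < N) (hα0 : 0 ≤ α) (hα1 : α < 1) (hαβ : 0 < α + β)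
    (hq1 : 1 ≤ q) (hq : 1 / q = 1 + (α + β - l) / N) :
    ∃ C : ℝ, 0 < C ∧ ∀ u : EuclideanSpace ℝ (Fin N) → 𝕜,
      ContDiff ℝ ∞ u → HasCompactSupport u →
      MemLp (fun x => (‖x‖ ^ α) • SteinWeiss.vectorRiesz u x) 1 volume →
      eLpNorm (fun x => (‖x‖ ^ (-β)) • SteinWeiss.rieszPotential l u x)
          (ENNReal.ofReal q) volume ≤
        ENNReal.ofReal C *
          eLpNorm (fun x => (‖x‖ ^ α) • SteinWeiss.vectorRiesz u x) 1 volume := by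
  obtain ⟨A, hA0, hA⟩ := SteinWeiss.exists_enorm_rieszPotential_le (𝕜 := 𝕜) hN hl0 hlN
  obtain ⟨B, hB, hBF⟩ := SteinWeiss.exists_lintegral_rpow_lintegral_cancelledKernel_le
    (by omega) hα0 hα1 hlN hαβ hq1 hq
  have hq0 : 0 < q := by linarith
  have hBq : B ^ (1 / q) ≠ ⊤ := ENNReal.rpow_ne_top_of_nonneg (by positivity) hB
  -- The summand `1` only makes the constant strictly positive.
  refine ⟨A * (B ^ (1 / q)).toReal + 1, by positivity, fun u hu hc hL => ?_⟩
  have hint := SteinWeiss.integrable_rieszTransform hN hu hc hα0 hL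
  have : Nontrivial (EuclideanSpace ℝ (Fin N)) :=
    Module.nontrivial_of_finrank_pos (R := ℝ) (by rw [finrank_euclideanSpace_fin]; omega)
  have hne : ∀ᵐ y : EuclideanSpace ℝ (Fin N), y ≠ 0 :=
    measure_eq_zero_iff_ae_notMem.1 (measure_singleton 0)
  have hF := hBF (fun y => ‖SteinWeiss.vectorRiesz u y‖ₑ)
    (SteinWeiss.continuous_vectorRiesz hN hu hc).measurable.enorm
  have hR : eLpNorm (fun x => (‖x‖ ^ α) • SteinWeiss.vectorRiesz u x) 1 volume =
      ∫⁻ y, ENNReal.ofReal (‖y‖ ^ α) * ‖SteinWeiss.vectorRiesz u y‖ₑ := by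
    rw [eLpNorm_one_eq_lintegral_enorm]
    refine lintegral_congr fun y => ?_
    rw [enorm_smul, Real.enorm_of_nonneg (by positivity)]
  rw [hR, eLpNorm_eq_lintegral_rpow_enorm_toReal (by simpa using hq0) ENNReal.ofReal_ne_top,
    ENNReal.toReal_ofReal hq0.le]
  set W := ∫⁻ y, ENNReal.ofReal (‖y‖ ^ α) * ‖SteinWeiss.vectorRiesz u y‖ₑ with hW
  have hpt : ∫⁻ x, ‖(‖x‖ ^ (-β)) • SteinWeiss.rieszPotential l u x‖ₑ ^ q ≤
      ENNReal.ofReal A ^ q * (B * W ^ q) := by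
    refine le_trans ?_ (mul_le_mul_right hF (ENNReal.ofReal A ^ q))
    rw [← lintegral_const_mul' _ _ (ENNReal.rpow_ne_top_of_nonneg hq0.le ENNReal.ofReal_ne_top)]
    refine lintegral_mono_ae ?_
    filter_upwards [hne] with x hx
    rw [← ENNReal.mul_rpow_of_nonneg _ _ hq0.le, enorm_smul,
      Real.enorm_of_nonneg (by positivity), mul_left_comm]
    exact ENNReal.rpow_le_rpow (mul_le_mul_right (hA u hu hc hint x hx) _) hq0.le
  calc _ ≤ (ENNReal.ofReal A ^ q * (B * W ^ q)) ^ (1 / q) :=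
        ENNReal.rpow_le_rpow hpt (by positivity)
    _ = ENNReal.ofReal A * B ^ (1 / q) * W := by
        rw [ENNReal.mul_rpow_of_nonneg _ _ (by positivity),
          ENNReal.mul_rpow_of_nonneg _ _ (by positivity), ← ENNReal.rpow_mul, ← ENNReal.rpow_mul,
          mul_one_div_cancel hq0.ne', ENNReal.rpow_one, ENNReal.rpow_one, mul_assoc]
    _ ≤ _ := by
        gcongr 1
        rw [ENNReal.ofReal_add (by positivity) zero_le_one, ENNReal.ofReal_mul hA0,
          ENNReal.ofReal_toReal hBq]
        exact le_self_add
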